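/- An instance of Incremental Stable Roommates with Ties (ISR-T) consists of a finite set $A$ of agents, two preference profiles $\mathcal P_1,\mathcal P_2$ over $A$, a stable matching $M_1$ in $\mathcal P_1$, and an integer $k$; the question is whether there is a stable matching $M_2$ in $\mathcal P_2$ with $|M_1\triangle M_2|\le k$. Here a preference profile gives for each agent $a$ a set $\mathrm{Ac}(a)\subseteq A\setminus\{a\}$ of accepted agents (acceptance being symmetric) and a weak order $\succsim_a$ on $\mathrm{Ac}(a)$; a matching is a set of pairwise disjoint pairs of agents accepting each other; and a matching is stable if there are no two agents that accept each other, each of which is unmatched or strictly prefers the other to its partner. In Incremental Stable Marriage with Ties (ISM-T) one is additionally given a partition $A=U\mathbin{\dot\cup}W$ such that, in both profiles, agents in $U$ accept only agents in $W$ and vice versa. The preferences of an agent $a$ are complete if $\mathrm{Ac}(a)=A\setminus\{a\}$ in ISR-T, and if $\mathrm{Ac}(a)=W$ for $a\in U$, respectively $\mathrm{Ac}(a)=U$ for $a\in W$, in ISM-T. They are derived from a weak master list $\succsim^*$, a weak order on $A$, if $\succsim_a$ is the restriction of $\succsim^*$ to $\mathrm{Ac}(a)$. Then ISM-T and ISR-T,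 each restricted to the instances in which the preferences of all agents in $\mathcal P_2$ are complete and derived from one common weak master list, can be solved (decided) in polynomial time. -/

import Mathlib

/-! ## Preferences, matchings, stability -/

namespace StableRoommates

/-- A preference profile with ties over the agent set `A`: `Acc a b` says that `a` accepts `b`
(acceptance is symmetric and nobody accepts itself), and `Pref a b c` is the weak order
`b ≿_a c` of agent `a` over the agents it accepts. -/
structure Profile (A : Type) where
  Acc : A → A → Prop
  Pref : A → A → A → Prop
  acc_irrefl : ∀ a, ¬ Acc a a
  acc_symm : ∀ a b, Acc a b → Acc b a
  pref_acc : ∀ a b c, Pref a b c → Acc a b ∧ Acc a c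
  pref_total : ∀ a b c, Acc a b → Acc a c → Pref a b c ∨ Pref a c b
  pref_trans : ∀ a b c d, Pref a b c → Pref a c d → Pref a b d

namespace Profile

variable {A : Type}

/-- `b ≻_a c`: agent `a` strictly prefers `b` to `c`. -/
def Strict (P : Profile A) (a b c : A) : Prop := P.Pref a b c ∧ ¬ P.Pref a c b

/-- A matching: a set of unordered pairs of distinct agents accepting each other such that each
agent is in at most one pair. -/
def IsMatching (P : Profile A) (M : Finset (Sym2 A)) : Prop :=
  (∀ a b, s(a, b) ∈ M → a ≠ b ∧ P.Acc a b ∧ P.Acc b a) ∧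
    ∀ a b c, s(a, b) ∈ M → s(a, c) ∈ M → b = c

/-- `b ≻_a M(a)`: agent `a` accepts `b` and is either unmatched in `M` (any acceptable agent is
strictly preferred to being unmatched) or strictly prefers `b` to its partner. -/
def PrefersToPartner (P : Profile A) (M : Finset (Sym2 A)) (a b : A) : Prop :=
  P.Acc a b ∧ ∀ c, s(a, c) ∈ M → P.Strict a b c

/-- The agents `a` and `b` block `M`. -/
def Blocks (P : Profile A) (M : Finset (Sym2 A)) (a b : A) : Prop :=
  a ≠ b ∧ P.PrefersToPartner M a b ∧ P.PrefersToPartner M b a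

/-- A (weakly) stable matching. -/
def IsStable (P : Profile A) (M : Finset (Sym2 A)) : Prop :=
  P.IsMatching M ∧ ∀ a b, ¬ P.Blocks M a b

/-- Complete preferences in the roommates setting: everybody accepts all other agents. -/
def Complete (P : Profile A) : Prop := ∀ a b, P.Acc a b ↔ a ≠ b

/-- Every agent of `U` accepts only agents outside `U`, and the other way round. -/
def Bipartite (P : Profile A) (U : Finset A) : Prop :=
  ∀ a b, P.Acc a b → (a ∈ U ↔ b ∉ U)

/-- Complete preferences in the marriage setting with men `U` and women `A \ U`:
everybody accepts precisely the agents of the other side. -/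
def BipartiteComplete (P : Profile A) (U : Finset A) : Prop :=
  ∀ a b, P.Acc a b ↔ (a ∈ U ↔ b ∉ U)

/-- All preferences are the restrictions to the acceptable agents of one weak master list, i.e. of
one weak order `L` over all agents. -/
def FromWeakMasterList (P : Profile A) : Prop :=
  ∃ L : A → A → Prop, (∀ b c, L b c ∨ L c b) ∧ (∀ b c d, L b c → L c d → L b d) ∧
    ∀ a b c, P.Acc a b → P.Acc a c → (P.Pref a b c ↔ L b c)

end Profile

/-! ## The incremental problems -/

/-- An instance of Incremental Stable Roommates with Ties; the agents are numbered. -/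
structure ISRT where
  n : ℕ
  P₁ : Profile (Fin n)
  P₂ : Profile (Fin n)
  M₁ : Finset (Sym2 (Fin n))
  stable₁ : P₁.IsStable M₁
  k : ℤ

/-- The question: is there a matching `M₂` stable in `P₂` with `|M₁ △ M₂| ≤ k`? -/
def ISRT.Yes (I : ISRT) : Prop :=
  ∃ M₂ : Finset (Sym2 (Fin I.n)), I.P₂.IsStable M₂ ∧ ((symmDiff I.M₁ M₂).card : ℤ) ≤ I.k

/-- An instance of Incremental Stable Marriage with Ties: an instance of Incremental Stable
Roommates with Ties together with a partition of the agents into the set `U` of men and its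
complement, the set of women, such that men accept only women and women only men. -/
structure ISMT extends ISRT where
  U : Finset (Fin n)
  bip₁ : P₁.Bipartite U
  bip₂ : P₂.Bipartite U

def ISMT.Yes (I : ISMT) : Prop := I.toISRT.Yes

/-! ## Instances as bit strings

A profile is written as the two tables of its relations, row by row; the number of agents is
written in unary, and the bound `k` in binary (sign bit, then the bits of `|k|`, the least
significant one first). -/

open Classical in
noncomputable def encodeSet {n : ℕ} (S : Finset (Fin n)) : List Bool :=
  (List.finRange n).map fun a => decide (a ∈ S)

open Classical in
noncomputable def encodeMatching {n : ℕ} (M : Finset (Sym2 (Fin n))) : List Bool :=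
  (List.finRange n).flatMap fun a => (List.finRange n).map fun b => decide (s(a, b) ∈ M)

open Classical in
noncomputable def encodeProfile {n : ℕ} (P : Profile (Fin n)) : List Bool :=
  ((List.finRange n).flatMap fun a => (List.finRange n).map fun b => decide (P.Acc a b)) ++
    (List.finRange n).flatMap fun a => (List.finRange n).flatMap fun b =>
      (List.finRange n).map fun c => decide (P.Pref a b c)

def encodeInt (k : ℤ) : List Bool := decide (k < 0) :: k.natAbs.bits

noncomputable def ISRT.encode (I : ISRT) : List Bool :=
  List.replicate I.n true ++ [false] ++ encodeProfile I.P₁ ++ encodeProfile I.P₂ ++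
    encodeMatching I.M₁ ++ encodeInt I.k

noncomputable def ISMT.encode (I : ISMT) : List Bool :=
  List.replicate I.n true ++ [false] ++ encodeSet I.U ++ encodeProfile I.P₁ ++
    encodeProfile I.P₂ ++ encodeMatching I.M₁ ++ encodeInt I.k

end StableRoommates

/-! ## Polynomial time on a random access machine -/

namespace RAM

/-- A state of the machine: directly addressed registers and an indirectly addressed memory, both
holding natural numbers. (A program mentions only finitely many registers.) -/
structure State where
  reg : ℕ → ℕ
  mem : ℕ → ℕ

def State.setReg (s : State) (i v : ℕ) : State := ⟨Function.update s.reg i v, s.mem⟩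

def State.setMem (s : State) (a v : ℕ) : State := ⟨s.reg, Function.update s.mem a v⟩

/-- Programs of a random access machine with addition and truncated subtraction, in structured
form. There is no multiplication and no other instruction by which the bit length of the numbers
could grow by more than one per step, so that unit costs are polynomially equivalent to the
running time of a Turing machine. -/
inductive Prog where
  | skip : Prog
  | const (i v : ℕ) : Prog -- reg i := v
  | copy (i j : ℕ) : Prog -- reg i := reg j
  | plus (i j l : ℕ) : Prog -- reg i := reg j + reg l
  | minus (i j l : ℕ) : Prog -- reg i := max (reg j - reg l) 0
  | load (i j : ℕ) : Prog -- reg i := mem (reg j)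
  | store (i j : ℕ) : Prog -- mem (reg i) := reg j
  | seq (p q : Prog) : Prog
  | ifPos (i : ℕ) (p q : Prog) : Prog -- if reg i ≠ 0 then p else q
  | whilePos (i : ℕ) (p : Prog) : Prog -- while reg i ≠ 0 do p

/-- `Runs p s s' t`: started in `s`, the program `p` halts in `s'` after exactly `t` steps; each
elementary instruction and each evaluation of a test is one step. -/
inductive Runs : Prog → State → State → ℕ → Prop where
  | skip (s : State) : Runs Prog.skip s s 1
  | const (i v : ℕ) (s : State) : Runs (Prog.const i v) s (s.setReg i v) 1
  | copy (i j : ℕ) (s : State) : Runs (Prog.copy i j) s (s.setReg i (s.reg j)) 1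
  | plus (i j l : ℕ) (s : State) :
      Runs (Prog.plus i j l) s (s.setReg i (s.reg j + s.reg l)) 1
  | minus (i j l : ℕ) (s : State) :
      Runs (Prog.minus i j l) s (s.setReg i (s.reg j - s.reg l)) 1
  | load (i j : ℕ) (s : State) : Runs (Prog.load i j) s (s.setReg i (s.mem (s.reg j))) 1
  | store (i j : ℕ) (s : State) : Runs (Prog.store i j) s (s.setMem (s.reg i) (s.reg j)) 1
  | seq {p q : Prog} {s₁ s₂ s₃ : State} {t₁ t₂ : ℕ} :
      Runs p s₁ s₂ t₁ → Runs q s₂ s₃ t₂ → Runs (Prog.seq p q) s₁ s₃ (t₁ + t₂)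
  | ifTrue {i : ℕ} {p q : Prog} {s s' : State} {t : ℕ} :
      s.reg i ≠ 0 → Runs p s s' t → Runs (Prog.ifPos i p q) s s' (t + 1)
  | ifFalse {i : ℕ} {p q : Prog} {s s' : State} {t : ℕ} :
      s.reg i = 0 → Runs q s s' t → Runs (Prog.ifPos i p q) s s' (t + 1)
  | whileDone {i : ℕ} {p : Prog} {s : State} :
      s.reg i = 0 → Runs (Prog.whilePos i p) s s 1
  | whileStep {i : ℕ} {p : Prog} {s₁ s₂ s₃ : State} {t₁ t₂ : ℕ} :
      s₁.reg i ≠ 0 → Runs p s₁ s₂ t₁ → Runs (Prog.whilePos i p) s₂ s₃ t₂ →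
        Runs (Prog.whilePos i p) s₁ s₃ (t₁ + t₂ + 1)

/-- The start state on the bit string `w`: memory cell `i` holds the `i`th bit, register `0` holds
the length of `w`, and everything else is `0`. -/
def init (w : List Bool) : State where
  reg := Function.update (fun _ => 0) 0 w.length
  mem := fun i => (w.getD i false).toNat

open Classical in
/-- The decision problem `Yes`, restricted to the inputs satisfying `Promise` and written as bit
strings by `enc`, is solvable in polynomial time: one program halts on every such input within
a number of steps polynomial in the length of the bit string, with the right answer (`1` for yes
and `0` for no) in register `0`. -/
def SolvableInPolyTime {α : Type} (enc : α → List Bool) (Promise Yes : α → Prop) : Prop :=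
  ∃ (p : Prog) (b : Polynomial ℕ), ∀ x : α, Promise x →
    ∃ (s : State) (t : ℕ), Runs p (init (enc x)) s t ∧ t ≤ b.eval (enc x).length ∧
      s.reg 0 = if Yes x then 1 else 0

end RAM

/-! ## Polynomial-time functions on the random access machine -/

namespace RAM

/-! Complete preferences from one weak master list amount to a rank for each agent; agents of equal
rank on the same side are interchangeable. Two facts turn the question into counting.

First, all stable matchings in the second profile have the same number of edges between any two
ranks. Among the best `x` agents of one side and the best `y` of the other there are exactly `min x
y` partner pairs, since otherwise an agent left over on each side would block
(`card_darts_of_bipartiteComplete`). Without sides the same argument works except for `x = y`, where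
one agent is left over if `x` is odd (`card_darts_of_complete`). Inclusion-exclusion gives the
number of edges between two single ranks (`cardDartsAt_eq_edgesAt`).

Second, permuting agents within a rank and a side preserves stability. A stable matching with the
largest overlap with the old matching therefore contains, for all pairs of ranks at once, as many
old edges as the two counts allow: an unused old edge and a new edge of the same type could be made
to coincide by swaps (`exists_max_overlap`). A stable matching exists (`exists_isStable`), so the
least symmetric difference is the sum of the two sizes minus twice the sum of these minima.

It remains to evaluate this formula in polynomial time. The ranks are recovered from the preference
tables (`rankedBy_rank`), and everything becomes nested sums of length at most the number of agents.
The class of functions computed on a read-only input is closed under such sums (`PolyTime.fold`), so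
no intermediate table is ever stored. -/

/-- A context: values stored in finitely many registers, on a machine whose memory holds the bit
string `word`. -/
class Context (α : Type) where
  word : α → List Bool
  dim : ℕ
  val : α → ℕ → ℕ

open Context

instance {α : Type} [Context α] : Context (α × ℕ) where
  word x := word x.1
  dim := dim α + 1
  val x i := if i < dim α then val x.1 i else x.2

/-- The context of an input, given by its encoding; the length of the code is in a register. -/
@[reducible] def Context.ofEncoding {α : Type} (enc : α → List Bool) : Context α where
  word := enc
  dim := 1
  val x _ := (enc x).length

/-- `f` is computed in polynomial time by programs which find the values of the context in given
registers below `D`, leave the registers below `D` and the memory as they are, and put the result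
into register `D`. -/
def PolyTime {α : Type} [Context α] (f : α → ℕ) : Prop :=
  ∀ (loc : ℕ → ℕ) (D : ℕ), (∀ i < dim α, loc i < D) →
    ∃ (p : Prog) (b : Polynomial ℕ), ∀ (x : α) (s : State),
      (∀ i < dim α, s.reg (loc i) = val x i) → s.mem = (init (word x)).mem →
      ∃ (s' : State) (t : ℕ), Runs p s s' t ∧ t ≤ b.eval (word x).length ∧
        s'.reg D = f x ∧ (∀ i < D, s'.reg i = s.reg i) ∧ s'.mem = s.mem

section

variable {α : Type} [Context α]

theorem PolyTime.fst {f : α → ℕ} (hf : PolyTime f) : PolyTime (fun y : α × ℕ => f y.1) := by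
  intro loc D hloc
  obtain ⟨p, b, hp⟩ := hf loc D fun i hi => hloc i (Nat.lt_succ_of_lt hi)
  refine ⟨p, b, fun y s hs hm => hp y.1 s (fun i hi => ?_) hm⟩
  rw [hs i (Nat.lt_succ_of_lt hi)]
  simp [val, hi]

theorem PolyTime.var {i : ℕ} (hi : i < dim α) : PolyTime (fun x : α => val x i) := by
  intro loc D hloc
  refine ⟨.copy D (loc i), 1, fun x s hs hm => ⟨_, _, .copy _ _ _, by simp, ?_, ?_, rfl⟩⟩
  · simp [State.setReg, hs i hi]
  · intro j hj
    simp [State.setReg, Function.update_of_ne (by omega : j ≠ D)]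

theorem PolyTime.last : PolyTime (fun x : α × ℕ => x.2) := by
  have := PolyTime.var (α := α × ℕ) (i := dim α) (Nat.lt_succ_self _)
  simpa [val] using this

theorem PolyTime.const (v : ℕ) : PolyTime (fun _ : α => v) := by
  intro loc D hloc
  refine ⟨.const D v, 1, fun x s hs hm => ⟨_, _, .const _ _ _, by simp, ?_, ?_, rfl⟩⟩
  · simp [State.setReg]
  · intro j hj
    simp [State.setReg, Function.update_of_ne (by omega : j ≠ D)]

/-- An elementary binary instruction. -/
theorem PolyTime.binary {op : ℕ → ℕ → ℕ} (ins : ℕ → ℕ → ℕ → Prog)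
    (hins : ∀ i j l s, Runs (ins i j l) s (s.setReg i (op (s.reg j) (s.reg l))) 1)
    {f g : α → ℕ} (hf : PolyTime f) (hg : PolyTime g) :
    PolyTime (fun x => op (f x) (g x)) := by
  intro loc D hloc
  obtain ⟨p, b, hp⟩ := hf loc D hloc
  obtain ⟨q, c, hq⟩ := hg loc (D + 1) (fun i hi => Nat.lt_succ_of_lt (hloc i hi))
  -- Asking for the second value in register `D + 1` protects the first one, which waits in register
  -- `D`.
  refine ⟨.seq p (.seq q (ins D D (D + 1))), b + c + 1, fun x s hs hm => ?_⟩
  obtain ⟨s₁, t₁, r₁, ht₁, hv₁, hk₁, hm₁⟩ := hp x s hs hm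
  obtain ⟨s₂, t₂, r₂, ht₂, hv₂, hk₂, hm₂⟩ := hq x s₁
    (fun i hi => by rw [hk₁ _ (hloc i hi), hs i hi]) (by rw [hm₁, hm])
  refine ⟨_, _, .seq r₁ (.seq r₂ (hins _ _ _ _)), ?_, ?_, ?_, ?_⟩
  · simp only [Polynomial.eval_add, Polynomial.eval_one]
    omega
  · simp [State.setReg, hv₂, hk₂ D (by omega), hv₁]
  · intro i hi
    simp only [State.setReg]
    rw [Function.update_of_ne (by omega), hk₂ i (by omega), hk₁ i hi]
  · simp [State.setReg, hm₂, hm₁]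

theorem PolyTime.add {f g : α → ℕ} (hf : PolyTime f) (hg : PolyTime g) :
    PolyTime (fun x => f x + g x) :=
  PolyTime.binary (op := (· + ·)) .plus (fun i j l s => .plus i j l s) hf hg

theorem PolyTime.sub {f g : α → ℕ} (hf : PolyTime f) (hg : PolyTime g) :
    PolyTime (fun x => f x - g x) :=
  PolyTime.binary (op := (· - ·)) .minus (fun i j l s => .minus i j l s) hf hg

/-- The bit of `w` at position `i`, as a number. -/
def bit (w : List Bool) (i : ℕ) : ℕ := (w.getD i false).toNat

theorem PolyTime.bit {f : α → ℕ} (hf : PolyTime f) :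
    PolyTime (fun x => RAM.bit (word x) (f x)) := by
  intro loc D hloc
  obtain ⟨p, b, hp⟩ := hf loc D hloc
  refine ⟨.seq p (.load D D), b + 1, fun x s hs hm => ?_⟩
  obtain ⟨s₁, t₁, r₁, ht₁, hv₁, hk₁, hm₁⟩ := hp x s hs hm
  refine ⟨_, _, .seq r₁ (.load _ _ _), ?_, ?_, ?_, ?_⟩
  · simp only [Polynomial.eval_add, Polynomial.eval_one]
    omega
  · simp [State.setReg, hv₁, hm₁, hm, init, RAM.bit]
  · intro i hi
    simp only [State.setReg]
    rw [Function.update_of_ne (by omega), hk₁ i hi]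
  · simp [State.setReg, hm₁]

theorem PolyTime.ite_eq_zero {f g h : α → ℕ} (hf : PolyTime f) (hg : PolyTime g)
    (hh : PolyTime h) : PolyTime (fun x => if f x = 0 then g x else h x) := by
  intro loc D hloc
  obtain ⟨p, b, hp⟩ := hf loc D hloc
  obtain ⟨q, c, hq⟩ := hg loc D hloc
  obtain ⟨r, d, hr⟩ := hh loc D hloc
  refine ⟨.seq p (.ifPos D r q), b + c + d + 1, fun x s hs hm => ?_⟩
  obtain ⟨s₁, t₁, r₁, ht₁, hv₁, hk₁, hm₁⟩ := hp x s hs hm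
  have hs₁ : ∀ i < dim α, s₁.reg (loc i) = val x i :=
    fun i hi => by rw [hk₁ _ (hloc i hi), hs i hi]
  by_cases h0 : f x = 0
  · obtain ⟨s₂, t₂, r₂, ht₂, hv₂, hk₂, hm₂⟩ := hq x s₁ hs₁ (by rw [hm₁, hm])
    refine ⟨_, _, .seq r₁ (.ifFalse (hv₁.trans h0) r₂), ?_, ?_, ?_, ?_⟩
    · simp only [Polynomial.eval_add, Polynomial.eval_one]
      omega
    · simp [h0, hv₂]
    · intro i hi
      rw [hk₂ i hi, hk₁ i hi]
    · rw [hm₂, hm₁]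
  · obtain ⟨s₂, t₂, r₂, ht₂, hv₂, hk₂, hm₂⟩ := hr x s₁ hs₁ (by rw [hm₁, hm])
    refine ⟨_, _, .seq r₁ (.ifTrue (by rwa [hv₁]) r₂), ?_, ?_, ?_, ?_⟩
    · simp only [Polynomial.eval_add, Polynomial.eval_one]
      omega
    · simp [h0, hv₂]
    · intro i hi
      rw [hk₂ i hi, hk₁ i hi]
    · rw [hm₂, hm₁]

theorem PolyTime.ite_le {f g h k : α → ℕ} (hf : PolyTime f) (hg : PolyTime g)
    (hh : PolyTime h) (hk : PolyTime k) :
    PolyTime (fun x => if f x ≤ g x then h x else k x) := by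
  simpa only [Nat.sub_eq_zero_iff_le] using (hf.sub hg).ite_eq_zero hh hk

theorem PolyTime.ite_lt {f g h k : α → ℕ} (hf : PolyTime f) (hg : PolyTime g)
    (hh : PolyTime h) (hk : PolyTime k) :
    PolyTime (fun x => if f x < g x then h x else k x) := by
  simpa only [Nat.succ_le_iff] using (hf.add (.const 1)).ite_le hg hh hk

theorem PolyTime.ite_eq {f g h k : α → ℕ} (hf : PolyTime f) (hg : PolyTime g)
    (hh : PolyTime h) (hk : PolyTime k) :
    PolyTime (fun x => if f x = g x then h x else k x) := by
  have := ((hf.sub hg).add (hg.sub hf)).ite_eq_zero hh hk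
  have e : ∀ a b : ℕ, a - b + (b - a) = 0 ↔ a = b := by omega
  simpa only [e] using this

theorem PolyTime.min {f g : α → ℕ} (hf : PolyTime f) (hg : PolyTime g) :
    PolyTime (fun x => Min.min (f x) (g x)) := by
  simpa only [← min_def] using hf.ite_le hg hf hg

/-- A function that is iterated at most as often as the input is long. -/
theorem PolyTime.fold {N f : α → ℕ} {F : α → ℕ → ℕ → ℕ} (hN : PolyTime N)
    (hb : ∀ x, N x ≤ (word x).length) (hf : PolyTime f)
    (hF : PolyTime (fun x : (α × ℕ) × ℕ => F x.1.1 x.1.2 x.2)) :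
    PolyTime (fun x => Nat.rec (motive := fun _ => ℕ) (f x) (F x) (N x)) := by
  intro loc D hloc
  obtain ⟨p, b, hp⟩ := hf loc D hloc
  obtain ⟨q, c, hq⟩ := hN loc (D + 1) (fun i hi => Nat.lt_succ_of_lt (hloc i hi))
  -- Register `D` holds the accumulator, `D + 1` the number of iterations left and `D + 2` the
  -- index. The program `r` delivers into `D + 3`, which then serves as the constant 1 for both
  -- counters.
  obtain ⟨r, d, hr⟩ := hF
    (fun i => if i < dim α then loc i else if i = dim α then D + 2 else D) (D + 3) (by
      intro i hi
      split_ifs with h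
      · have := hloc i h
        omega
      · omega
      · omega)
  let body : Prog := .seq r (.seq (.copy D (D + 3)) (.seq (.const (D + 3) 1)
    (.seq (.plus (D + 2) (D + 2) (D + 3)) (.minus (D + 1) (D + 1) (D + 3)))))
  -- The bound `d` depends only on the length of the word, not on index or accumulator, so all
  -- iterations cost the same. The 5 is four instructions and a test; the final 1 is the test that
  -- ends the loop.
  have loop : ∀ (m : ℕ) (x : α) (i : ℕ) (s : State),
      (∀ i < dim α, s.reg (loc i) = val x i) → s.mem = (init (word x)).mem →
      s.reg (D + 1) = m → s.reg (D + 2) = i →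
      s.reg D = Nat.rec (motive := fun _ => ℕ) (f x) (F x) i →
      ∃ (s' : State) (t : ℕ), Runs (.whilePos (D + 1) body) s s' t ∧
        t ≤ m * (d.eval (word x).length + 5) + 1 ∧
        s'.reg D = Nat.rec (motive := fun _ => ℕ) (f x) (F x) (i + m) ∧
        (∀ i < D, s'.reg i = s.reg i) ∧ s'.mem = s.mem := by
    intro m
    induction m with
    | zero =>
      intro x i s hs hm h1 h2 h3
      exact ⟨s, 1, .whileDone h1, by omega, h3, fun _ _ => rfl, rfl⟩
    | succ m ih =>
      intro x i s hs hm h1 h2 h3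
      obtain ⟨s₁, t₁, r₁, ht₁, hv₁, hk₁, hm₁⟩ := hr ((x, i), s.reg D) s (by
        intro j hj
        simp only [val]
        have hj' : j < dim α + 1 + 1 := hj
        by_cases hj1 : j < dim α
        · have hj2 : j < dim α + 1 := by omega
          simp only [dim, hj1, hj2, if_true, hs j hj1]
        · by_cases hj2 : j = dim α
          · simp [dim, hj2, h2]
          · have hj3 : ¬ j < dim α + 1 := by omega
            simp [dim, hj1, hj2, hj3]) hm
      have step := Runs.seq r₁ (.seq (.copy D (D + 3) _) (.seq (.const (D + 3) 1 _)
        (.seq (.plus (D + 2) (D + 2) (D + 3) _) (.minus (D + 1) (D + 1) (D + 3) _))))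
      set s₂ := State.setReg _ (D + 1) _ with hs₂
      have e0 : s₂.reg D = Nat.rec (motive := fun _ => ℕ) (f x) (F x) (i + 1) := by
        simp [hs₂, State.setReg, hv₁, h3]
      have e1 : s₂.reg (D + 1) = m := by
        simp [hs₂, State.setReg, hk₁ (D + 1) (by omega), h1]
      have e2 : s₂.reg (D + 2) = i + 1 := by
        simp [hs₂, State.setReg, hk₁ (D + 2) (by omega), h2]
      have ek : ∀ j < D, s₂.reg j = s.reg j := by
        intro j hj
        simp only [hs₂, State.setReg]
        rw [Function.update_of_ne (by omega), Function.update_of_ne (by omega),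
          Function.update_of_ne (by omega), Function.update_of_ne (by omega), hk₁ j (by omega)]
      have em : s₂.mem = s.mem := by
        simp [hs₂, State.setReg, hm₁]
      obtain ⟨s', t, rr, ht, hv, hk, hmm⟩ := ih x (i + 1) s₂
        (fun j hj => by rw [ek _ (hloc j hj), hs j hj]) (by rw [em, hm]) e1 e2 e0
      refine ⟨s', _, .whileStep (by omega) step rr, ?_, ?_, ?_, ?_⟩
      · have e := Nat.succ_mul m (d.eval (word x).length + 5)
        have ht₁' : t₁ ≤ d.eval (word x).length := ht₁
        rw [Nat.succ_eq_add_one] at e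
        omega
      · rw [hv, show i + 1 + m = i + (m + 1) by omega]
      · intro j hj
        rw [hk j hj, ek j hj]
      · rw [hmm, em]
  refine ⟨.seq p (.seq q (.seq (.const (D + 2) 0) (.whilePos (D + 1) body))),
    b + c + 2 + Polynomial.X * (d + 5), fun x s hs hm => ?_⟩
  obtain ⟨s₁, t₁, r₁, ht₁, hv₁, hk₁, hm₁⟩ := hp x s hs hm
  obtain ⟨s₂, t₂, r₂, ht₂, hv₂, hk₂, hm₂⟩ := hq x s₁
    (fun i hi => by rw [hk₁ _ (hloc i hi), hs i hi]) (by rw [hm₁, hm])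
  have ek : ∀ j < D, (s₂.setReg (D + 2) 0).reg j = s.reg j := by
    intro j hj
    simp only [State.setReg]
    rw [Function.update_of_ne (by omega), hk₂ j (by omega), hk₁ j hj]
  obtain ⟨s', t, rr, ht, hv, hk, hmm⟩ := loop (N x) x 0 (s₂.setReg (D + 2) 0)
    (fun j hj => by rw [ek _ (hloc j hj), hs j hj]) (by simp [State.setReg, hm₂, hm₁, hm])
    (by simp [State.setReg, hv₂]) (by simp [State.setReg])
    (by simp [State.setReg, hk₂ D (by omega), hv₁])
  refine ⟨s', _, .seq r₁ (.seq r₂ (.seq (.const _ _ _) rr)), ?_, ?_, ?_, ?_⟩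
  · have := Nat.mul_le_mul_right (d.eval (word x).length + 5) (hb x)
    simp only [Polynomial.eval_add, Polynomial.eval_mul, Polynomial.eval_X,
      Polynomial.eval_ofNat]
    omega
  · rw [hv, Nat.zero_add]
  · intro j hj
    rw [hk j hj, ek j hj]
  · rw [hmm]
    simp [State.setReg, hm₂, hm₁]

theorem PolyTime.sum {N : α → ℕ} {F : α → ℕ → ℕ} (hN : PolyTime N)
    (hb : ∀ x, N x ≤ (word x).length) (hF : PolyTime (fun x : α × ℕ => F x.1 x.2)) :
    PolyTime (fun x => ∑ i ∈ Finset.range (N x), F x i) := by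
  have h := PolyTime.fold (F := fun x i a => a + F x i) hN hb (PolyTime.const 0)
    (PolyTime.last.add hF.fst)
  have e : ∀ (x : α) (m : ℕ), Nat.rec (motive := fun _ => ℕ) 0 (fun i a => a + F x i) m =
      ∑ i ∈ Finset.range m, F x i := by
    intro x m
    induction m with
    | zero => rfl
    | succ m ih => rw [Finset.sum_range_succ, ← ih]
  simpa only [e] using h

/-- The machine cannot multiply; repeated addition is affordable because one factor is at most the
input length. -/
theorem PolyTime.mul {N f : α → ℕ} (hN : PolyTime N)
    (hb : ∀ x, N x ≤ (word x).length) (hf : PolyTime f) :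
    PolyTime (fun x => N x * f x) := by
  simpa using PolyTime.sum (F := fun x _ => f x) hN hb hf.fst

theorem PolyTime.const_mul (c : ℕ) {f : α → ℕ} (hf : PolyTime f) :
    PolyTime (fun x => c * f x) := by
  induction c with
  | zero => simpa using PolyTime.const 0
  | succ c ih => simpa only [Nat.succ_mul] using ih.add hf

end

theorem PolyTime.length {α : Type} (enc : α → List Bool) :
    letI := Context.ofEncoding enc
    PolyTime (fun x : α => (enc x).length) := by
  let := Context.ofEncoding enc
  exact PolyTime.var (α := α) (i := 0) Nat.zero_lt_one

open Classical in
/-- A decision problem is solvable in polynomial time if its characteristic function is a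
polynomial-time function. -/
theorem SolvableInPolyTime.of_polyTime {α : Type} {enc : α → List Bool} {Promise Yes : α → Prop}
    {f : {x // Promise x} → ℕ}
    (hf : letI := Context.ofEncoding (fun x : {x // Promise x} => enc x); PolyTime f)
    (h : ∀ x, f x = if Yes x then 1 else 0) : SolvableInPolyTime enc Promise Yes := by
  let := Context.ofEncoding (fun x : {x // Promise x} => enc x)
  obtain ⟨p, b, hp⟩ := hf (fun _ => 0) 1 (fun _ _ => Nat.zero_lt_one)
  refine ⟨.seq p (.copy 0 1), b + 1, fun x hx => ?_⟩
  obtain ⟨s, t, r, ht, hv, -, -⟩ := hp ⟨x, hx⟩ (init (enc x)) (fun _ _ => by simp [init, val]) rfl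
  refine ⟨_, _, .seq r (.copy _ _ _), ?_, ?_⟩
  · simp only [Polynomial.eval_add, Polynomial.eval_one]
    exact Nat.succ_le_succ ht
  · simp [State.setReg, hv, h]

end RAM

/-! ## Reading the encodings -/

namespace RAM

theorem bit_append_left {v w : List Bool} {i : ℕ} (h : i < v.length) :
    bit (v ++ w) i = bit v i := by
  simp [bit, List.getElem?_append_left h]

theorem bit_append_right (v w : List Bool) (i : ℕ) : bit (v ++ w) (v.length + i) = bit w i := by
  rw [bit, bit, List.getD_append_right _ _ _ _ (Nat.le_add_right _ _), Nat.add_sub_cancel_left]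

theorem toNat_decide (p : Prop) [Decidable p] : (decide p).toNat = if p then 1 else 0 := by
  by_cases h : p <;> simp [h]

theorem length_flatMap_of_const {ι : Type} {l : List ι} {g : ι → List Bool} {m : ℕ}
    (h : ∀ a, (g a).length = m) : (l.flatMap g).length = l.length * m := by
  induction l with
  | nil => simp
  | cons a l ih =>
    rw [List.flatMap_cons, List.length_append, ih, h, List.length_cons]
    ring

theorem bit_flatMap {ι : Type} {l : List ι} {g : ι → List Bool} {m : ℕ}
    (h : ∀ a, (g a).length = m) (i : ℕ) (hi : i < l.length) {j : ℕ} (hj : j < m) :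
    bit (l.flatMap g) (m * i + j) = bit (g l[i]) j := by
  induction l generalizing i with
  | nil => simp at hi
  | cons a l ih =>
    rw [List.flatMap_cons]
    cases i with
    | zero => simpa using bit_append_left (by rwa [h])
    | succ i =>
      rw [show m * (i + 1) + j = (g a).length + (m * i + j) by rw [h]; ring, bit_append_right]
      exact ih i (by simpa using hi)

theorem bit_map_finRange {n : ℕ} (f : Fin n → Bool) (a : Fin n) :
    bit ((List.finRange n).map f) a = (f a).toNat := by
  simp [bit]

theorem length_table {n : ℕ} (f : Fin n → Fin n → Bool) :
    ((List.finRange n).flatMap fun a => (List.finRange n).map (f a)).length = n * n := by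
  rw [length_flatMap_of_const (m := n) (by simp), List.length_finRange]

theorem bit_table {n : ℕ} (f : Fin n → Fin n → Bool) (a b : Fin n) :
    bit ((List.finRange n).flatMap fun a => (List.finRange n).map (f a)) (n * a + b) =
      (f a b).toNat := by
  rw [bit_flatMap (by simp) a (by simp) b.2, bit_map_finRange]
  simp

theorem length_table₃ {n : ℕ} (f : Fin n → Fin n → Fin n → Bool) :
    ((List.finRange n).flatMap fun a => (List.finRange n).flatMap fun b =>
      (List.finRange n).map (f a b)).length = n * (n * n) := by
  rw [length_flatMap_of_const (fun a => length_table (f a)), List.length_finRange]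

theorem bit_table₃ {n : ℕ} (f : Fin n → Fin n → Fin n → Bool) (a b c : Fin n) :
    bit ((List.finRange n).flatMap fun a => (List.finRange n).flatMap fun b =>
      (List.finRange n).map (f a b)) (n * (n * a) + (n * b + c)) = (f a b c).toNat := by
  have hj : n * b + c < n * n := by
    have := Nat.mul_le_mul_left n (Nat.succ_le_iff.2 b.2)
    have := c.2
    rw [Nat.succ_eq_add_one, mul_add] at *
    omega
  rw [← mul_assoc, bit_flatMap (fun a => length_table (f a)) a (by simp) hj, bit_table]
  simp

/-- The number of leading ones of `w`. -/
def leadingOnes (w : List Bool) : ℕ :=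
  -- The accumulator is itself the position being read: it moves past ones and stays at the first
  -- zero.
  Nat.rec (motive := fun _ => ℕ) 0 (fun _ a => if bit w a = 0 then a else a + 1) w.length

theorem leadingOnes_replicate_append (n : ℕ) (w : List Bool) :
    leadingOnes (List.replicate n true ++ false :: w) = n := by
  have h1 : ∀ i < n, bit (List.replicate n true ++ false :: w) i = 1 := by
    intro i hi
    rw [bit_append_left (by simpa)]
    simp [bit, hi]
  have h2 : bit (List.replicate n true ++ false :: w) n = 0 := by
    simp [bit]
  have key : ∀ m, Nat.rec (motive := fun _ => ℕ) 0
      (fun _ a => if bit (List.replicate n true ++ false :: w) a = 0 then a else a + 1) m =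
      min m n := by
    intro m
    induction m with
    | zero => simp
    | succ m ih =>
      simp only [ih]
      rcases lt_or_ge m n with h | h
      · rw [min_eq_left h.le, h1 m h, min_eq_left h]
        simp
      · rw [min_eq_right h, h2, min_eq_right (by omega)]
        simp
  rw [leadingOnes, key, min_eq_right]
  simp

/-- The number whose binary digits, the least significant one first, are the bits of `w` from
position `q` on. -/
def binaryFrom (w : List Bool) (q : ℕ) : ℕ :=
  -- Horner's scheme, read backwards from the end of the word, where the most significant bit
  -- stands.
  Nat.rec (motive := fun _ => ℕ) 0 (fun j a => a + a + bit w (w.length - 1 - j)) (w.length - q)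

theorem foldr_bits (k : ℕ) : k.bits.foldr (fun b a => a + a + b.toNat) 0 = k := by
  induction k using Nat.binaryRec' with
  | zero => simp
  | bit b k h ih =>
    rw [Nat.bits_append_bit _ _ h, List.foldr_cons, ih, Nat.bit_val]
    ring

theorem binaryFrom_append_bits (v : List Bool) (k : ℕ) :
    binaryFrom (v ++ k.bits) v.length = k := by
  have key : ∀ m ≤ k.bits.length, Nat.rec (motive := fun _ => ℕ) 0
      (fun j a => a + a + bit (v ++ k.bits) ((v ++ k.bits).length - 1 - j)) m =
      (k.bits.drop (k.bits.length - m)).foldr (fun b a => a + a + b.toNat) 0 := by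
    intro m
    induction m with
    | zero => simp
    | succ m ih =>
      intro hm
      have hlt : k.bits.length - (m + 1) < k.bits.length := by omega
      simp only [ih (by omega)]
      rw [List.drop_eq_getElem_cons hlt, List.foldr_cons,
        show k.bits.length - (m + 1) + 1 = k.bits.length - m by omega,
        show (v ++ k.bits).length - 1 - m = v.length + (k.bits.length - (m + 1)) by
          rw [List.length_append]; omega, bit_append_right]
      simp only [bit, List.getD_eq_getElem _ _ hlt]
  have e : (v ++ k.bits).length - v.length = k.bits.length := by simp
  rw [binaryFrom, e, key _ le_rfl, Nat.sub_self, List.drop_zero, foldr_bits]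

section

open Context

variable {α : Type} [Context α]

theorem PolyTime.leadingOnes (h : PolyTime fun x : α => (word x).length) :
    PolyTime fun x : α => RAM.leadingOnes (word x) :=
  PolyTime.fold (F := fun x _ a => if RAM.bit (word x) a = 0 then a else a + 1) h
    (fun _ => le_rfl) (.const 0)
    ((PolyTime.bit (α := (α × ℕ) × ℕ) .last).ite_eq_zero .last (PolyTime.last.add (.const 1)))

theorem PolyTime.binaryFrom (h : PolyTime fun x : α => (word x).length) {q : α → ℕ}
    (hq : PolyTime q) : PolyTime fun x : α => RAM.binaryFrom (word x) (q x) :=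
  PolyTime.fold (F := fun x j a => a + a + RAM.bit (word x) ((word x).length - 1 - j)) (h.sub hq)
    (fun _ => Nat.sub_le _ _) (.const 0) ((PolyTime.last.add .last).add
      (PolyTime.bit (α := (α × ℕ) × ℕ) ((h.fst.fst.sub (.const 1)).sub PolyTime.last.fst)))

end

end RAM

namespace StableRoommates

open RAM

theorem length_encodeSet {n : ℕ} (S : Finset (Fin n)) : (encodeSet S).length = n := by
  simp [encodeSet]

theorem length_encodeProfile {n : ℕ} (P : Profile (Fin n)) :
    (encodeProfile P).length = n * n + n * (n * n) := by
  classical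
  rw [encodeProfile, List.length_append]
  exact congrArg₂ _ (length_table _) (length_table₃ _)

theorem length_encodeMatching {n : ℕ} (M : Finset (Sym2 (Fin n))) :
    (encodeMatching M).length = n * n := length_table _

open Classical in
theorem bit_encodeSet {n : ℕ} (S : Finset (Fin n)) (a : Fin n) :
    bit (encodeSet S) a = if a ∈ S then 1 else 0 := by
  rw [encodeSet, bit_map_finRange]
  exact toNat_decide _

open Classical in
theorem bit_encodeProfile {n : ℕ} (P : Profile (Fin n)) (a b c : Fin n) :
    bit (encodeProfile P) (n * n + (n * (n * a) + (n * b + c))) =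
      if P.Pref a b c then 1 else 0 := by
  have h := bit_append_right ((List.finRange n).flatMap fun a => (List.finRange n).map fun b =>
    decide (P.Acc a b)) ((List.finRange n).flatMap fun a => (List.finRange n).flatMap fun b =>
      (List.finRange n).map fun c => decide (P.Pref a b c)) (n * (n * a) + (n * b + c))
  rw [length_table, bit_table₃] at h
  rw [encodeProfile, h]
  exact toNat_decide _

open Classical in
theorem bit_encodeMatching {n : ℕ} (M : Finset (Sym2 (Fin n))) (a b : Fin n) :
    bit (encodeMatching M) (n * a + b) = if s(a, b) ∈ M then 1 else 0 := by
  rw [encodeMatching, bit_table]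
  exact toNat_decide _

end StableRoommates

/-! ## Stable matchings for a weak master list -/

namespace StableRoommates

open Finset

variable {A : Type}

/-- No loops, and edges sharing an end coincide. -/
def DisjointEdges (M : Finset (Sym2 A)) : Prop :=
  (∀ a b, s(a, b) ∈ M → a ≠ b) ∧ ∀ a b c, s(a, b) ∈ M → s(a, c) ∈ M → b = c

theorem Profile.IsMatching.disjointEdges {P : Profile A} {M : Finset (Sym2 A)}
    (h : P.IsMatching M) : DisjointEdges M :=
  ⟨fun a b hab => (h.1 a b hab).1, h.2⟩

/-! ### Exchanging agents of the same type -/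

section Exchange

variable [DecidableEq A] {T : Type} {τ : A → T}

/-- The product of the transpositions of `a`, `c` and of `b`, `d` works unless the edges meet
crosswise, `c = b` or `d = a`. Then all four types agree, and one transposition of the remaining
ends suffices. -/
theorem exists_perm_map_eq {a b c d : A} (hab : a ≠ b) (hcd : c ≠ d) (hne : s(a, b) ≠ s(c, d))
    (hac : τ a = τ c) (hbd : τ b = τ d) :
    ∃ π : Equiv.Perm A, (∀ x, τ (π x) = τ x) ∧ Sym2.map π s(c, d) = s(a, b) ∧
      ∀ x, x ≠ a → x ≠ b → x ≠ c → x ≠ d → π x = x := by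
  have swap_type : ∀ x y, τ x = τ y → ∀ z, τ (Equiv.swap x y z) = τ z := by
    intro x y h z
    rcases eq_or_ne z x with rfl | hx
    · rw [Equiv.swap_apply_left, h]
    rcases eq_or_ne z y with rfl | hy
    · rw [Equiv.swap_apply_right, h]
    rw [Equiv.swap_apply_of_ne_of_ne hx hy]
  rcases eq_or_ne c b with rfl | hcb
  · have hda : d ≠ a := by
      rintro rfl
      exact hne Sym2.eq_swap
    refine ⟨Equiv.swap a d, swap_type _ _ (hac.trans hbd), ?_, fun x h1 _ _ h4 =>
      Equiv.swap_apply_of_ne_of_ne h1 h4⟩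
    rw [Sym2.map_mk, Equiv.swap_apply_right, Equiv.swap_apply_of_ne_of_ne hab.symm hcd,
      Sym2.eq_swap]
  rcases eq_or_ne d a with rfl | hda
  · refine ⟨Equiv.swap b c, swap_type _ _ (hbd.trans hac), ?_, fun x _ h2 h3 _ =>
      Equiv.swap_apply_of_ne_of_ne h2 h3⟩
    rw [Sym2.map_mk, Equiv.swap_apply_right, Equiv.swap_apply_of_ne_of_ne hab hcd.symm,
      Sym2.eq_swap]
  · refine ⟨Equiv.swap a c * Equiv.swap b d, fun x => ?_, ?_, fun x h1 h2 h3 h4 => ?_⟩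
    · rw [Equiv.Perm.mul_apply, swap_type _ _ hac, swap_type _ _ hbd]
    · rw [Sym2.map_mk, Equiv.Perm.mul_apply, Equiv.Perm.mul_apply, Equiv.swap_apply_right,
        Equiv.swap_apply_of_ne_of_ne hcb hcd, Equiv.swap_apply_right,
        Equiv.swap_apply_of_ne_of_ne hab.symm hcb.symm]
    · rw [Equiv.Perm.mul_apply, Equiv.swap_apply_of_ne_of_ne h2 h4,
        Equiv.swap_apply_of_ne_of_ne h1 h3]

/-- Moving `s(c, d)` onto `s(a, b)` gains a common edge and loses none: a common edge touches none
of the four agents, since its matching would force it to equal `s(a, b)` or `s(c, d)`, and neither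
of these is common. -/
theorem exists_perm_card_inter_lt {M₁ M₂ : Finset (Sym2 A)} (h₁ : DisjointEdges M₁)
    (h₂ : DisjointEdges M₂) {a b c d : A} (hab : s(a, b) ∈ M₁) (hab' : s(a, b) ∉ M₂)
    (hcd : s(c, d) ∈ M₂) (hcd' : s(c, d) ∉ M₁) (hac : τ a = τ c) (hbd : τ b = τ d) :
    ∃ π : Equiv.Perm A, (∀ x, τ (π x) = τ x) ∧
      #(M₁ ∩ M₂) < #(M₁ ∩ M₂.image (Sym2.map π)) := by
  obtain ⟨π, hτ, hπ, hfix⟩ := exists_perm_map_eq (h₁.1 a b hab) (h₂.1 c d hcd)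
    (fun h => hcd' (h ▸ hab)) hac hbd
  refine ⟨π, hτ, card_lt_card ?_⟩
  have fixed : ∀ x y, s(x, y) ∈ M₁ → s(x, y) ∈ M₂ → π x = x := by
    intro x y hx₁ hx₂
    apply hfix
    · rintro rfl
      rw [h₁.2 _ _ _ hx₁ hab] at hx₂
      exact hab' hx₂
    · rintro rfl
      rw [h₁.2 _ _ _ hx₁ (Sym2.eq_swap ▸ hab), Sym2.eq_swap] at hx₂
      exact hab' hx₂
    · rintro rfl
      rw [h₂.2 _ _ _ hx₂ hcd] at hx₁
      exact hcd' hx₁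
    · rintro rfl
      rw [h₂.2 _ _ _ hx₂ (Sym2.eq_swap ▸ hcd), Sym2.eq_swap] at hx₁
      exact hcd' hx₁
  refine Finset.ssubset_iff_subset_ne.2 ⟨fun e => ?_, fun h => ?_⟩
  · induction e with | _ x y
    intro he
    rw [mem_inter] at he ⊢
    refine ⟨he.1, mem_image.2 ⟨s(x, y), he.2, ?_⟩⟩
    rw [Sym2.map_mk, fixed x y he.1 he.2,
      fixed y x (Sym2.eq_swap ▸ he.1) (Sym2.eq_swap ▸ he.2)]
  · have : s(a, b) ∈ M₁ ∩ M₂ := by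
      rw [h, mem_inter]
      exact ⟨hab, mem_image.2 ⟨_, hcd, hπ⟩⟩
    exact hab' (mem_inter.1 this).2

variable [Fintype A] [DecidableEq T]

/-- In a family of matchings that is closed under the type-preserving permutations, some member
contains, for all types, as many edges of `M₁` between these types as possible. -/
theorem exists_max_overlap {S : Set (Finset (Sym2 A))} (hne : S.Nonempty)
    (hS : ∀ M ∈ S, DisjointEdges M)
    (hπ : ∀ M ∈ S, ∀ π : Equiv.Perm A, (∀ x, τ (π x) = τ x) → M.image (Sym2.map π) ∈ S)
    {M₁ : Finset (Sym2 A)} (h₁ : DisjointEdges M₁) :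
    ∃ M₂ ∈ S, ∀ t t', min #{p : A × A | s(p.1, p.2) ∈ M₁ ∧ τ p.1 = t ∧ τ p.2 = t'}
        #{p : A × A | s(p.1, p.2) ∈ M₂ ∧ τ p.1 = t ∧ τ p.2 = t'} ≤
      #{p : A × A | s(p.1, p.2) ∈ M₁ ∩ M₂ ∧ τ p.1 = t ∧ τ p.2 = t'} := by
  obtain ⟨M₂, hM₂, hmax⟩ := Set.exists_max_image S (fun M => #(M₁ ∩ M)) (Set.toFinite S) hne
  -- Maximality of the total overlap yields all the local maxima at once: a deficit at a single pair
  -- of types leaves an edge of each matching there outside the other, and the exchange increases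
  -- the total.
  refine ⟨M₂, hM₂, fun t t' => ?_⟩
  by_contra! hlt
  obtain ⟨hlt₁, hlt₂⟩ := lt_min_iff.1 hlt
  obtain ⟨⟨a, b⟩, hab, hab'⟩ := exists_mem_notMem_of_card_lt_card hlt₁
  obtain ⟨⟨c, d⟩, hcd, hcd'⟩ := exists_mem_notMem_of_card_lt_card hlt₂
  simp only [mem_filter, mem_univ, true_and, mem_inter] at hab hab' hcd hcd'
  obtain ⟨π, hτ, hcard⟩ := exists_perm_card_inter_lt (τ := τ) h₁ (hS _ hM₂) hab.1
    (fun h => hab' ⟨⟨hab.1, h⟩, hab.2⟩) hcd.1 (fun h => hcd' ⟨⟨h, hcd.1⟩, hcd.2⟩)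
    (hab.2.1.trans hcd.2.1.symm) (hab.2.2.trans hcd.2.2.symm)
  exact absurd (hmax _ (hπ _ hM₂ π hτ)) (by simpa using hcard)

end Exchange

/-! ### Counting edges by ordered pairs -/

section Counting

variable [DecidableEq A]

theorem two_mul_card_eq_card_darts [Fintype A] {M : Finset (Sym2 A)}
    (h : ∀ a b, s(a, b) ∈ M → a ≠ b) : 2 * #M = #{p : A × A | s(p.1, p.2) ∈ M} := by
  have hf : ∀ p ∈ ({p : A × A | s(p.1, p.2) ∈ M} : Finset (A × A)), s(p.1, p.2) ∈ M :=
    fun p hp => (mem_filter.1 hp).2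
  rw [card_eq_sum_card_fiberwise hf, mul_comm]
  refine (sum_const_nat fun e => ?_).symm
  induction e with | _ a b
  intro he
  rw [show ({p ∈ ({p : A × A | s(p.1, p.2) ∈ M} : Finset (A × A)) | s(p.1, p.2) = s(a, b)}) =
    {(a, b), (b, a)} by
      ext ⟨x, y⟩
      simp only [mem_filter, mem_univ, true_and, mem_insert, mem_singleton, Prod.mk.injEq,
        Sym2.eq_iff]
      constructor
      · exact fun h => h.2
      · rintro (⟨rfl, rfl⟩ | ⟨rfl, rfl⟩)
        · exact ⟨he, .inl ⟨rfl, rfl⟩⟩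
        · exact ⟨Sym2.eq_swap ▸ he, .inr ⟨rfl, rfl⟩⟩]
  refine card_pair fun hp => h a b he ?_
  exact (Prod.mk.inj hp).1

theorem card_eq_card_darts_of_bipartite [Fintype A] {M : Finset (Sym2 A)} {U : Finset A}
    (h : ∀ a b, s(a, b) ∈ M → (a ∈ U ↔ b ∉ U)) :
    #M = #{p ∈ U ×ˢ Uᶜ | s(p.1, p.2) ∈ M} := by
  refine (card_bij (fun p _ => s(p.1, p.2)) (fun p hp => (mem_filter.1 hp).2) ?_ ?_).symm
  · rintro ⟨a, b⟩ hp ⟨c, d⟩ hq hpq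
    simp only [mem_filter, mem_product, mem_compl] at hp hq
    rcases Sym2.eq_iff.1 hpq with ⟨h1, h2⟩ | ⟨h1, h2⟩
    · exact Prod.ext h1 h2
    · simp only at h1
      exact absurd (h1 ▸ hp.1.1) hq.1.2
  · intro e
    induction e with | _ a b
    intro he
    by_cases ha : a ∈ U
    · exact ⟨(a, b), by simp [he, ha, (h a b he).1 ha], rfl⟩
    · have hb : b ∈ U := by
        by_contra hb
        exact ha ((h a b he).2 hb)
      refine ⟨(b, a), ?_, Sym2.eq_swap⟩
      simp only [mem_filter, mem_product, mem_compl]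
      exact ⟨⟨hb, ha⟩, Sym2.eq_swap ▸ he⟩

theorem card_symmDiff_add {M₁ M₂ : Finset (Sym2 A)} :
    #(symmDiff M₁ M₂) + 2 * #(M₁ ∩ M₂) = #M₁ + #M₂ := by
  have h1 := card_sdiff_add_card_inter M₁ M₂
  have h2 := card_sdiff_add_card_inter M₂ M₁
  rw [inter_comm] at h2
  have h3 : #(symmDiff M₁ M₂) = #(M₁ \ M₂) + #(M₂ \ M₁) := by
    rw [symmDiff_def, sup_eq_union, card_union_of_disjoint]
    exact disjoint_sdiff_sdiff
  omega

theorem card_image_fst_darts {M : Finset (Sym2 A)} (h : DisjointEdges M)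
    (D : Finset (A × A)) (hD : ∀ p ∈ D, s(p.1, p.2) ∈ M) : #(D.image Prod.fst) = #D := by
  refine card_image_of_injOn ?_
  rintro ⟨a, b⟩ hp ⟨c, d⟩ hq hpq
  obtain rfl : a = c := hpq
  exact Prod.ext rfl (h.2 a b d (hD _ hp) (hD _ hq))

theorem card_image_snd_darts {M : Finset (Sym2 A)} (h : DisjointEdges M)
    (D : Finset (A × A)) (hD : ∀ p ∈ D, s(p.1, p.2) ∈ M) : #(D.image Prod.snd) = #D := by
  refine card_image_of_injOn ?_
  rintro ⟨a, b⟩ hp ⟨c, d⟩ hq hpq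
  obtain rfl : b = d := hpq
  exact Prod.ext (h.2 b a c (Sym2.eq_swap ▸ hD _ hp) (Sym2.eq_swap ▸ hD _ hq)) rfl

end Counting

/-! ### Preferences given by ranks: symmetry and existence of stable matchings -/

/-- All agents rank the agents they accept by `r`, the smaller the better. -/
def Profile.RankedBy (P : Profile A) (r : A → ℕ) : Prop :=
  ∀ c a b, P.Acc c a → P.Acc c b → (P.Pref c a b ↔ r a ≤ r b)

namespace Profile.RankedBy

variable {P : Profile A} {r : A → ℕ}

theorem strict_iff (h : P.RankedBy r) {c a b : A} (ha : P.Acc c a) (hb : P.Acc c b) :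
    P.Strict c a b ↔ r a < r b := by
  rw [Profile.Strict, h c a b ha hb, h c b a hb ha]
  omega

/-- Stability in terms of ranks; for an unmatched agent the condition on its partner is vacuous. -/
theorem not_blocks (h : P.RankedBy r) {M : Finset (Sym2 A)} (hM : P.IsStable M) {a b : A}
    (hab : P.Acc a b) (ha : ∀ c, s(a, c) ∈ M → r b < r c) (hb : ∀ c, s(b, c) ∈ M → r a < r c) :
    False := by
  refine hM.2 a b ⟨fun e => P.acc_irrefl b (e ▸ hab), ⟨hab, fun c hc => ?_⟩,
    ⟨P.acc_symm _ _ hab, fun c hc => ?_⟩⟩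
  · exact (h.strict_iff hab (hM.1.1 a c hc).2.1).2 (ha c hc)
  · exact (h.strict_iff (P.acc_symm _ _ hab) (hM.1.1 b c hc).2.1).2 (hb c hc)

theorem isStable_image [DecidableEq A] (h : P.RankedBy r) {M : Finset (Sym2 A)}
    (hM : P.IsStable M) (π : Equiv.Perm A) (hacc : ∀ a b, P.Acc (π a) (π b) ↔ P.Acc a b)
    (hr : ∀ a, r (π a) = r a) : P.IsStable (M.image (Sym2.map π)) := by
  have key : ∀ a b, s(π a, π b) ∈ M.image (Sym2.map π) ↔ s(a, b) ∈ M := by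
    intro a b
    rw [← Sym2.map_mk, (Sym2.map.injective π.injective).mem_finset_image]
  refine ⟨⟨fun a b hab => ?_, fun a b c hab hac => ?_⟩, fun a b hab => ?_⟩
  · obtain ⟨a, rfl⟩ := π.surjective a
    obtain ⟨b, rfl⟩ := π.surjective b
    have := hM.1.1 a b ((key a b).1 hab)
    rwa [hacc, hacc, π.injective.ne_iff]
  · obtain ⟨a, rfl⟩ := π.surjective a
    obtain ⟨b, rfl⟩ := π.surjective b
    obtain ⟨c, rfl⟩ := π.surjective c
    rw [hM.1.2 a b c ((key _ _).1 hab) ((key _ _).1 hac)]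
  · obtain ⟨a, rfl⟩ := π.surjective a
    obtain ⟨b, rfl⟩ := π.surjective b
    obtain ⟨-, ⟨h1, h2⟩, ⟨h3, h4⟩⟩ := hab
    rw [hacc] at h1 h3
    refine h.not_blocks hM h1 (fun c hc => ?_) (fun c hc => ?_)
    · have hc' := (h.strict_iff ((hacc _ _).2 h1) ((hacc _ _).2 (hM.1.1 a c hc).2.1)).1
        (h2 (π c) ((key _ _).2 hc))
      rwa [hr, hr] at hc'
    · have hc' := (h.strict_iff ((hacc _ _).2 h3) ((hacc _ _).2 (hM.1.1 b c hc).2.1)).1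
        (h4 (π c) ((key _ _).2 hc))
      rwa [hr, hr] at hc'

/-- The weight of an edge; a matching of maximal weight is stable. -/
def weight (r : A → ℕ) (N : ℕ) : Sym2 A → ℕ :=
  Sym2.lift ⟨fun a b => 3 ^ (N - r a + (N - r b)), fun _ _ => congrArg (3 ^ ·) (Nat.add_comm _ _)⟩

/-- A blocking pair could replace the at most two edges at its ends. Each of these weighs at most a
third of the new edge, because one end stays and the other gets a strictly larger rank. So base 3
makes the replacement a strict gain, contradicting maximal weight. -/
theorem exists_isStable [Fintype A] (h : P.RankedBy r) : ∃ M, P.IsStable M := by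
  classical
  obtain ⟨N, hN⟩ : ∃ N, ∀ a, r a ≤ N := ⟨∑ a, r a, fun a => single_le_sum (f := r)
    (fun _ _ => Nat.zero_le _) (mem_univ a)⟩
  obtain ⟨M, hM, hmax⟩ := Set.exists_max_image {M | P.IsMatching M}
    (fun M => ∑ e ∈ M, weight r N e) (Set.toFinite _) ⟨∅, by simp [Profile.IsMatching]⟩
  refine ⟨M, hM, fun a b ⟨hne, ⟨hab, ha⟩, ⟨hba, hb⟩⟩ => ?_⟩
  have star : ∀ a b, P.Acc a b → (∀ c, s(a, c) ∈ M → P.Strict a b c) →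
      3 * ∑ e ∈ M with a ∈ e, weight r N e ≤ weight r N s(a, b) := by
    intro a b hab ha
    by_cases hc : ∃ c, s(a, c) ∈ M
    · obtain ⟨c, hc⟩ := hc
      have e : ({e ∈ M | a ∈ e} : Finset (Sym2 A)) = {s(a, c)} := by
        ext e
        simp only [mem_filter, mem_singleton]
        constructor
        · rintro ⟨he, d, rfl⟩
          rw [hM.2 a d c he hc]
        · rintro rfl
          exact ⟨hc, Sym2.mem_mk_left _ _⟩
      have hlt := (h.strict_iff hab (hM.1 a c hc).2.1).1 (ha c hc)
      have := hN c
      rw [e, sum_singleton]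
      simp only [weight, Sym2.lift_mk]
      rw [← pow_succ']
      exact Nat.pow_le_pow_right (by norm_num) (by omega)
    · rw [sum_eq_zero]
      · exact Nat.zero_le _
      · rintro e he
        obtain ⟨he, d, rfl⟩ := mem_filter.1 he
        exact absurd ⟨d, he⟩ hc
  set R := ({e ∈ M | a ∉ e ∧ b ∉ e} : Finset (Sym2 A)) with hR
  have hRmem : ∀ x y, s(x, y) ∈ R → s(x, y) ∈ M ∧ x ≠ a ∧ x ≠ b := by
    intro x y hxy
    obtain ⟨h1, h2, h3⟩ := mem_filter.1 hxy
    refine ⟨h1, ?_, ?_⟩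
    · rintro rfl
      exact h2 (Sym2.mem_mk_left _ _)
    · rintro rfl
      exact h3 (Sym2.mem_mk_left _ _)
  have hnot : s(a, b) ∉ R := fun hab => (hRmem _ _ hab).2.1 rfl
  have hmatch : P.IsMatching (insert s(a, b) R) := by
    refine ⟨fun x y hxy => ?_, fun x y z hxy hxz => ?_⟩
    · rcases mem_insert.1 hxy with hxy | hxy
      · rcases Sym2.eq_iff.1 hxy with ⟨rfl, rfl⟩ | ⟨rfl, rfl⟩
        · exact ⟨hne, hab, hba⟩
        · exact ⟨hne.symm, hba, hab⟩
      · exact hM.1 x y (hRmem _ _ hxy).1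
    · rcases mem_insert.1 hxy with hxy | hxy <;> rcases mem_insert.1 hxz with hxz | hxz
      · exact Sym2.congr_right.1 (hxy.trans hxz.symm)
      · obtain ⟨-, h1, h2⟩ := hRmem _ _ hxz
        rcases Sym2.eq_iff.1 hxy with ⟨rfl, rfl⟩ | ⟨rfl, rfl⟩
        · exact absurd rfl h1
        · exact absurd rfl h2
      · obtain ⟨-, h1, h2⟩ := hRmem _ _ hxy
        rcases Sym2.eq_iff.1 hxz with ⟨rfl, rfl⟩ | ⟨rfl, rfl⟩
        · exact absurd rfl h1
        · exact absurd rfl h2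
      · exact hM.2 x y z (hRmem _ _ hxy).1 (hRmem _ _ hxz).1
  have h1 := hmax _ hmatch
  simp only [sum_insert hnot] at h1
  -- Only an inequality, since an edge through both `a` and `b` would be counted twice on the right.
  have h2 : ∑ e ∈ M, weight r N e ≤ ∑ e ∈ R, weight r N e +
      ∑ e ∈ M with a ∈ e, weight r N e + ∑ e ∈ M with b ∈ e, weight r N e := by
    rw [hR, sum_filter, sum_filter, sum_filter, ← sum_add_distrib, ← sum_add_distrib]
    refine sum_le_sum fun e _ => ?_
    by_cases hae : a ∈ e <;> by_cases hbe : b ∈ e <;> simp [hae, hbe]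
  have h3 := star a b hab ha
  have h4 := star b a hba hb
  rw [Sym2.eq_swap] at h4
  have h5 : 0 < weight r N s(a, b) := by
    simp only [weight, Sym2.lift_mk]
    positivity
  omega

end Profile.RankedBy

end StableRoommates

namespace StableRoommates

open Finset

/-! ### Edge counts common to all stable matchings -/

section Counts

variable {A : Type} [Fintype A] [DecidableEq A] {P : Profile A} {r : A → ℕ}

/-- The number of agents of `V` whose rank is less than `s`. -/
def below (V : Finset A) (r : A → ℕ) (s : ℕ) : ℕ := #{a ∈ V | r a < s}

theorem card_darts_of_bipartiteComplete (h : P.RankedBy r) {U : Finset A}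
    (hc : P.BipartiteComplete U) {M : Finset (Sym2 A)} (hM : P.IsStable M) (s s' : ℕ) :
    #{p ∈ U ×ˢ Uᶜ | s(p.1, p.2) ∈ M ∧ r p.1 < s ∧ r p.2 < s'} =
      min (below U r s) (below Uᶜ r s') := by
  set D : Finset (A × A) := {p ∈ U ×ˢ Uᶜ | s(p.1, p.2) ∈ M ∧ r p.1 < s ∧ r p.2 < s'} with hD
  have hmem : ∀ a b, (a, b) ∈ D ↔ (a ∈ U ∧ b ∉ U) ∧ s(a, b) ∈ M ∧ r a < s ∧ r b < s' := by
    simp [hD]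
  have hDM : ∀ p ∈ D, s(p.1, p.2) ∈ M := fun p hp => ((hmem _ _).1 hp).2.1
  have h1 := card_image_fst_darts hM.1.disjointEdges D hDM
  have h2 := card_image_snd_darts hM.1.disjointEdges D hDM
  have s1 : D.image Prod.fst ⊆ ({a ∈ U | r a < s} : Finset A) := by
    intro a ha
    obtain ⟨⟨a, b⟩, hp, rfl⟩ := mem_image.1 ha
    have := (hmem _ _).1 hp
    exact mem_filter.2 ⟨this.1.1, this.2.2.1⟩
  have s2 : D.image Prod.snd ⊆ ({a ∈ Uᶜ | r a < s'} : Finset A) := by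
    intro b hb
    obtain ⟨⟨a, b⟩, hp, rfl⟩ := mem_image.1 hb
    have := (hmem _ _).1 hp
    exact mem_filter.2 ⟨mem_compl.2 this.1.2, this.2.2.2⟩
  refine le_antisymm (le_min (h1 ▸ card_le_card s1) (h2 ▸ card_le_card s2)) ?_
  -- With too few pairs, some `u` among the best on the left and some `w` among the best on the
  -- right have no partner in the other group. Any partner they have is then worse than `w`,
  -- respectively `u`, so the two block.
  by_contra! hlt
  obtain ⟨hlt₁, hlt₂⟩ := lt_min_iff.1 hlt
  rw [← h1] at hlt₁
  rw [← h2] at hlt₂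
  obtain ⟨u, hu, hu'⟩ := exists_mem_notMem_of_card_lt_card hlt₁
  obtain ⟨w, hw, hw'⟩ := exists_mem_notMem_of_card_lt_card hlt₂
  simp only [mem_filter, mem_compl] at hu hw
  refine h.not_blocks hM ((hc u w).2 ⟨fun _ => hw.1, fun _ => hu.1⟩) (fun c huc => ?_)
    (fun c hwc => ?_)
  · by_contra hle
    have hcU := ((hc u c).1 (hM.1.1 u c huc).2.1).1 hu.1
    exact hu' (mem_image.2 ⟨(u, c), (hmem _ _).2 ⟨⟨hu.1, hcU⟩, huc, hu.2, by omega⟩, rfl⟩)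
  · by_contra hle
    rw [Sym2.eq_swap] at hwc
    have hcU := ((hc c w).1 (hM.1.1 c w hwc).2.1).2 hw.1
    exact hw' (mem_image.2 ⟨(c, w), (hmem _ _).2 ⟨⟨hcU, hw.1⟩, hwc, by omega, hw.2⟩, rfl⟩)

/-- The number of ordered pairs of partners, one among the best `x` and one among the best `y`
agents, in a stable matching for a complete weak master list. -/
def partnersWithin (x y : ℕ) : ℕ := if x = y then x - x % 2 else min x y

theorem card_darts_of_complete_of_le (h : P.RankedBy r) (hc : P.Complete) {M : Finset (Sym2 A)}
    (hM : P.IsStable M) {s s' : ℕ} (hs : s ≤ s') :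
    #{p : A × A | s(p.1, p.2) ∈ M ∧ r p.1 < s ∧ r p.2 < s'} =
      partnersWithin (below univ r s) (below univ r s') := by
  have hsub : ({a | r a < s} : Finset A) ⊆ ({a | r a < s'} : Finset A) := by
    intro a ha
    simp only [mem_filter, mem_univ, true_and] at ha ⊢
    omega
  have hle : below univ r s ≤ below univ r s' := card_le_card hsub
  have image_fst : ∀ s', ({p : A × A | s(p.1, p.2) ∈ M ∧ r p.1 < s ∧ r p.2 < s'} :
      Finset (A × A)).image Prod.fst ⊆ ({a | r a < s} : Finset A) := by
    intro s' a ha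
    obtain ⟨⟨a, b⟩, hp, rfl⟩ := mem_image.1 ha
    simp only [mem_filter, mem_univ, true_and] at hp ⊢
    exact hp.2.1
  have unmatched : ∀ {a s'}, a ∈ ({a | r a < s} : Finset A) →
      a ∉ ({p : A × A | s(p.1, p.2) ∈ M ∧ r p.1 < s ∧ r p.2 < s'} :
        Finset (A × A)).image Prod.fst → r a < s ∧ ∀ c, s(a, c) ∈ M → s' ≤ r c := by
    intro a s' ha ha'
    simp only [mem_filter, mem_univ, true_and] at ha
    refine ⟨ha, fun c hac => ?_⟩
    by_contra hlt
    exact ha' (mem_image.2 ⟨(a, c), by simp [hac, ha, Nat.lt_of_not_le hlt], rfl⟩)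
  have hcard : ∀ s', #(({p : A × A | s(p.1, p.2) ∈ M ∧ r p.1 < s ∧ r p.2 < s'} :
      Finset (A × A)).image Prod.fst) = #{p : A × A | s(p.1, p.2) ∈ M ∧ r p.1 < s ∧ r p.2 < s'} :=
    fun s' => card_image_fst_darts hM.1.disjointEdges _ fun p hp => (mem_filter.1 hp).2.1
  -- If the larger group is strictly larger, it has a member `b` outside the smaller one. Suppose
  -- `a` in the smaller group has no partner in the larger. Then `a` blocks with the partner of `b`,
  -- if that partner lies in the smaller group, and with `b` itself otherwise.
  rcases hle.lt_or_eq with hlt | heq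
  · rw [partnersWithin, if_neg hlt.ne, min_eq_left hle, ← hcard]
    refine congrArg card (Subset.antisymm (image_fst s') fun a ha => ?_)
    by_contra ha'
    obtain ⟨has, hac⟩ := unmatched ha ha'
    obtain ⟨b, hb, hb'⟩ := exists_mem_notMem_of_card_lt_card hlt
    simp only [mem_filter, mem_univ, true_and, not_lt] at hb hb'
    by_cases hcb : ∃ c, s(b, c) ∈ M ∧ r c < s
    · obtain ⟨c, hbc, hcs⟩ := hcb
      have hne : a ≠ c := by
        rintro rfl
        have := hac b (Sym2.eq_swap ▸ hbc)
        omega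
      refine h.not_blocks hM ((hc a c).2 hne) (fun d hd => ?_) (fun d hd => ?_)
      · have := hac d hd
        omega
      · rw [← hM.1.2 c b d (Sym2.eq_swap ▸ hbc) hd]
        omega
    · push Not at hcb
      have hne : a ≠ b := by
        rintro rfl
        omega
      refine h.not_blocks hM ((hc a b).2 hne) (fun d hd => ?_) (fun d hd => ?_)
      · have := hac d hd
        omega
      · have := hcb d hd
        omega
  · rw [partnersWithin, if_pos heq]
    have hXY : ∀ a, r a < s ↔ r a < s' := by
      have := eq_of_subset_of_card_le hsub heq.ge
      intro a
      simpa using congrArg (a ∈ ·) this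
    simp only [← hXY]
    have hle1 := card_le_card (image_fst s)
    rw [hcard] at hle1
    -- For equal groups, two agents without a partner inside would block each other, so at most one
    -- is left over. The number of ordered pairs inside is even, and this decides whether there is
    -- one.
    have hle2 : #(({a | r a < s} : Finset A) \ ({p : A × A | s(p.1, p.2) ∈ M ∧ r p.1 < s ∧
        r p.2 < s} : Finset (A × A)).image Prod.fst) ≤ 1 := by
      refine card_le_one.2 fun a ha b hb => ?_
      by_contra hne
      obtain ⟨ha₁, ha₂⟩ := unmatched (mem_sdiff.1 ha).1 (mem_sdiff.1 ha).2
      obtain ⟨hb₁, hb₂⟩ := unmatched (mem_sdiff.1 hb).1 (mem_sdiff.1 hb).2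
      refine h.not_blocks hM ((hc a b).2 hne) (fun d hd => ?_) (fun d hd => ?_)
      · have := ha₂ d hd
        omega
      · have := hb₂ d hd
        omega
    rw [card_sdiff_of_subset (image_fst s), hcard] at hle2
    have heven := two_mul_card_eq_card_darts (M := {e ∈ M | ∀ a ∈ e, r a < s})
      fun a b hab => (hM.1.1 a b (mem_filter.1 hab).1).1
    simp only [mem_filter, Sym2.mem_iff, forall_eq_or_imp, forall_eq] at heven
    rw [below]
    omega

theorem card_darts_of_complete (h : P.RankedBy r) (hc : P.Complete) {M : Finset (Sym2 A)}
    (hM : P.IsStable M) (s s' : ℕ) :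
    #{p : A × A | s(p.1, p.2) ∈ M ∧ r p.1 < s ∧ r p.2 < s'} =
      partnersWithin (below univ r s) (below univ r s') := by
  rcases le_total s s' with hs | hs
  · exact card_darts_of_complete_of_le h hc hM hs
  · have hcomm : ∀ x y, partnersWithin x y = partnersWithin y x := by
      intro x y
      unfold partnersWithin
      split_ifs <;> omega
    rw [hcomm, ← card_darts_of_complete_of_le h hc hM hs]
    refine card_bij (fun p _ => p.swap) ?_ (fun p _ q _ hpq => Prod.swap_injective hpq) ?_
    · rintro ⟨a, b⟩ hp
      simp only [mem_filter, mem_univ, true_and, Prod.swap] at hp ⊢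
      exact ⟨Sym2.eq_swap ▸ hp.1, hp.2.2, hp.2.1⟩
    · rintro ⟨a, b⟩ hp
      simp only [mem_filter, mem_univ, true_and] at hp
      exact ⟨(b, a), by simp [hp, Sym2.eq_swap (a := b)], rfl⟩

end Counts

/-! ### The criterion for a stable matching close to the given one -/

section Overlap

variable {A : Type} [DecidableEq A]

/-- The number of pairs in `V × V'` that are edges of `M`. -/
def cardDarts (V V' : Finset A) (M : Finset (Sym2 A)) : ℕ := #{p ∈ V ×ˢ V' | s(p.1, p.2) ∈ M}

/-- The number of pairs in `V × V'` of ranks `t` and `t'` that are edges of `M`. -/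
def cardDartsAt (V V' : Finset A) (r : A → ℕ) (M : Finset (Sym2 A)) (t t' : ℕ) : ℕ :=
  #{p ∈ V ×ˢ V' | s(p.1, p.2) ∈ M ∧ r p.1 = t ∧ r p.2 = t'}

/-- The number of edges between the ranks `t` and `t'`, if `g x y` is the number of edges between
the `x` best agents of one and the `y` best agents of the other side. -/
def edgesAt (g : ℕ → ℕ → ℕ) (l l' : ℕ → ℕ) (t t' : ℕ) : ℕ :=
  -- Inclusion-exclusion, with both additions first so that truncated subtraction does no harm.
  g (l (t + 1)) (l' (t' + 1)) + g (l t) (l' t') - g (l t) (l' (t' + 1)) - g (l (t + 1)) (l' t')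

variable {V V' : Finset A} {r : A → ℕ}

theorem cardDartsAt_eq_edgesAt {g : ℕ → ℕ → ℕ} {l l' : ℕ → ℕ} {M : Finset (Sym2 A)}
    (h : ∀ s s', #{p ∈ V ×ˢ V' | s(p.1, p.2) ∈ M ∧ r p.1 < s ∧ r p.2 < s'} = g (l s) (l' s'))
    (t t' : ℕ) : cardDartsAt V V' r M t t' = edgesAt g l l' t t' := by
  have key : #{p ∈ V ×ˢ V' | s(p.1, p.2) ∈ M ∧ r p.1 < t + 1 ∧ r p.2 < t' + 1} +
      #{p ∈ V ×ˢ V' | s(p.1, p.2) ∈ M ∧ r p.1 < t ∧ r p.2 < t'} =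
      #{p ∈ V ×ˢ V' | s(p.1, p.2) ∈ M ∧ r p.1 < t ∧ r p.2 < t' + 1} +
      #{p ∈ V ×ˢ V' | s(p.1, p.2) ∈ M ∧ r p.1 < t + 1 ∧ r p.2 < t'} + cardDartsAt V V' r M t t' := by
    simp only [cardDartsAt, card_filter, ← sum_add_distrib]
    refine sum_congr rfl fun p _ => ?_
    by_cases hp : s(p.1, p.2) ∈ M
    · simp only [hp, true_and]
      split_ifs <;> omega
    · simp [hp]
  rw [h, h, h, h] at key
  rw [edgesAt]
  omega

theorem cardDarts_eq_sum {n : ℕ} (hr : ∀ a, r a < n) (M : Finset (Sym2 A)) :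
    cardDarts V V' M = ∑ t ∈ range n, ∑ t' ∈ range n, cardDartsAt V V' r M t t' := by
  rw [cardDarts, card_eq_sum_card_fiberwise (f := fun p => (r p.1, r p.2)) (t := range n ×ˢ range n)
    (fun p _ => by simp [hr]), sum_product]
  refine sum_congr rfl fun t _ => sum_congr rfl fun t' _ => ?_
  rw [cardDartsAt, filter_filter]
  simp only [Prod.mk.injEq]

/-- Common to both problems: `κ` is the number of ordered pairs in `V × V'` per edge, and `v`
records whether `V'` is `V` or its complement. The predicate `edge` is needed because `M₁` is not
assumed to be a matching for `P`, while the pair counts must apply to it as well. As the sizes are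
fixed, only the overlap varies: it is bounded rank by rank by the minima, and `exists_max_overlap`
attains all of these bounds together. -/
theorem exists_stable_card_symmDiff_le_iff [Fintype A] {P : Profile A} {n κ : ℕ} {k : ℤ}
    {g : ℕ → ℕ → ℕ} {M₁ : Finset (Sym2 A)} (hP : P.RankedBy r) (hr : ∀ a, r a < n) (hκ : 0 < κ)
    {v : Bool} (hv : ∀ a, a ∈ V' ↔ decide (a ∈ V) = v)
    {edge : A → A → Prop} (h₁ : DisjointEdges M₁) (h₁' : ∀ a b, s(a, b) ∈ M₁ → edge a b)
    (hedge : ∀ a b, P.Acc a b → edge a b)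
    (hdarts : ∀ M : Finset (Sym2 A), (∀ a b, s(a, b) ∈ M → edge a b) → κ * #M = cardDarts V V' M)
    (hacc : ∀ π : Equiv.Perm A, (∀ a, π a ∈ V ↔ a ∈ V) → ∀ a b, P.Acc (π a) (π b) ↔ P.Acc a b)
    (hcount : ∀ M, P.IsStable M → ∀ s s',
      #{p ∈ V ×ˢ V' | s(p.1, p.2) ∈ M ∧ r p.1 < s ∧ r p.2 < s'} = g (below V r s) (below V' r s')) :
    (∃ M₂, P.IsStable M₂ ∧ (#(symmDiff M₁ M₂) : ℤ) ≤ k) ↔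
      ((cardDarts V V' M₁ + g (below V r n) (below V' r n) : ℕ) : ℤ) ≤ κ * k +
        (2 * ∑ t ∈ range n, ∑ t' ∈ range n,
          min (edgesAt g (below V r) (below V' r) t t') (cardDartsAt V V' r M₁ t t') : ℕ) := by
  have htotal : ∀ M, P.IsStable M → cardDarts V V' M = g (below V r n) (below V' r n) := by
    intro M hM
    rw [← hcount M hM]
    simp [cardDarts, hr]
  have hedge₂ : ∀ M, P.IsStable M → ∀ a b, s(a, b) ∈ M → edge a b :=
    fun M hM a b hab => hedge a b (hM.1.1 a b hab).2.1
  have hsymm : ∀ M, P.IsStable M → κ * #(symmDiff M₁ M) + 2 * cardDarts V V' (M₁ ∩ M) =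
      cardDarts V V' M₁ + g (below V r n) (below V' r n) := by
    intro M hM
    rw [← htotal M hM, ← hdarts M₁ h₁', ← hdarts M (hedge₂ M hM),
      ← hdarts (M₁ ∩ M) fun a b hab => h₁' a b (mem_inter.1 hab).1, ← mul_add,
      ← card_symmDiff_add]
    ring
  have hκ' : ∀ M : Finset (Sym2 A), (#(symmDiff M₁ M) : ℤ) ≤ k ↔
      ((κ * #(symmDiff M₁ M) : ℕ) : ℤ) ≤ κ * k := by
    intro M
    push_cast
    exact (mul_le_mul_iff_right₀ (by exact_mod_cast hκ)).symm
  constructor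
  · rintro ⟨M, hM, hk⟩
    have h1 := hsymm M hM
    have h2 : cardDarts V V' (M₁ ∩ M) ≤ ∑ t ∈ range n, ∑ t' ∈ range n,
        min (edgesAt g (below V r) (below V' r) t t') (cardDartsAt V V' r M₁ t t') := by
      rw [cardDarts_eq_sum hr]
      refine sum_le_sum fun t _ => sum_le_sum fun t' _ => le_min ?_ ?_
      · rw [← cardDartsAt_eq_edgesAt (hcount M hM)]
        refine card_le_card (monotone_filter_right _ fun p _ hp => ⟨(mem_inter.1 hp.1).2, hp.2⟩)
      · refine card_le_card (monotone_filter_right _ fun p _ hp => ⟨(mem_inter.1 hp.1).1, hp.2⟩)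
    rw [hκ'] at hk
    omega
  · intro hk
    obtain ⟨M, hM, hmax⟩ := exists_max_overlap (S := {M | P.IsStable M})
      (τ := fun a => (r a, decide (a ∈ V))) hP.exists_isStable
      (fun M hM => hM.1.disjointEdges) (fun M hM π hπ => by
        simp only [Prod.mk.injEq, decide_eq_decide] at hπ
        exact hP.isStable_image hM π (hacc π fun a => (hπ a).2) fun a => (hπ a).1) h₁
    refine ⟨M, hM, (hκ' M).2 ?_⟩
    have h1 := hsymm M hM
    have h2 : ∑ t ∈ range n, ∑ t' ∈ range n,
        min (edgesAt g (below V r) (below V' r) t t') (cardDartsAt V V' r M₁ t t') ≤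
        cardDarts V V' (M₁ ∩ M) := by
      rw [cardDarts_eq_sum hr]
      refine sum_le_sum fun t _ => sum_le_sum fun t' _ => ?_
      rw [← cardDartsAt_eq_edgesAt (hcount M hM), min_comm]
      have e : ∀ M : Finset (Sym2 A), cardDartsAt V V' r M t t' = #{p : A × A | s(p.1, p.2) ∈ M ∧
          (r p.1, decide (p.1 ∈ V)) = (t, true) ∧ (r p.2, decide (p.2 ∈ V)) = (t', v)} := by
        intro M
        refine congrArg card (ext fun p => ?_)
        simp only [mem_filter, mem_product, mem_univ, true_and, Prod.mk.injEq, hv,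
          decide_eq_true_eq]
        tauto
      rw [e, e, e]
      exact hmax _ _
    omega

end Overlap

end StableRoommates

namespace StableRoommates

open Finset

/-! ## Ranks -/

section Rank

variable {A : Type} [Fintype A]

open Classical in
/-- The number of agents that somebody strictly prefers to `a`. -/
noncomputable def Profile.rank (P : Profile A) (a : A) : ℕ := #{d | ∃ c, P.Strict c d a}

omit [Fintype A] in
theorem Profile.not_strict_self (P : Profile A) (c a : A) : ¬ P.Strict c a a :=
  fun h => h.2 h.1

theorem Profile.rank_lt_card (P : Profile A) (a : A) : P.rank a < Fintype.card A := by
  classical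
  refine card_lt_univ_of_notMem (x := a) fun h => ?_
  obtain ⟨c, hc⟩ := (mem_filter.1 h).2
  exact P.not_strict_self c a hc

/-- The master list is not part of the input, so ranks come from observed strict preferences. If `a`
is at least as good as `b`, every `d` seen above `a` lies above `b` in the list; `hobs` supplies an
agent that accepts `d` and `b` and thus sees it. If `b` is strictly better, `b` itself is counted
for `a` but not for `b`. -/
theorem Profile.FromWeakMasterList.rankedBy_rank {P : Profile A} (h : P.FromWeakMasterList)
    (hobs : ∀ c c' a b d, P.Acc c a → P.Acc c b → P.Acc c' d → P.Acc c' a → a ≠ b → d ≠ a →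
      d ≠ b → ∃ c'', P.Acc c'' d ∧ P.Acc c'' b) : P.RankedBy P.rank := by
  classical
  obtain ⟨L, htotal, htrans, hL⟩ := h
  have hstrict : ∀ {c d a}, P.Strict c d a → P.Acc c d ∧ P.Acc c a ∧ ¬ L a d := by
    intro c d a hs
    obtain ⟨h1, h2⟩ := P.pref_acc _ _ _ hs.1
    exact ⟨h1, h2, fun hl => hs.2 ((hL c a d h2 h1).2 hl)⟩
  have hstrict' : ∀ {c d a}, P.Acc c d → P.Acc c a → ¬ L a d → P.Strict c d a := by
    intro c d a h1 h2 hl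
    exact ⟨(hL c d a h1 h2).2 ((htotal d a).resolve_right hl),
      fun hp => hl ((hL c a d h2 h1).1 hp)⟩
  have sub : ∀ {c a b}, P.Acc c a → P.Acc c b → L a b →
      ({d | ∃ c, P.Strict c d a} : Finset A) ⊆ ({d | ∃ c, P.Strict c d b} : Finset A) := by
    intro c a b ha hb hab d hd
    rw [mem_filter] at hd ⊢
    obtain ⟨-, c', hc'⟩ := hd
    rcases eq_or_ne a b with rfl | hne
    · exact ⟨mem_univ _, c', hc'⟩
    obtain ⟨h1, h2, h3⟩ := hstrict hc'
    have hbd : ¬ L b d := fun hbd => h3 (htrans _ _ _ hab hbd)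
    have hda : d ≠ a := by
      rintro rfl
      exact P.not_strict_self _ _ hc'
    have hdb : d ≠ b := by
      rintro rfl
      exact hbd ((htotal d d).elim id id)
    obtain ⟨c'', h4, h5⟩ := hobs c c' a b d ha hb h1 h2 hne hda hdb
    exact ⟨mem_univ _, c'', hstrict' h4 h5 hbd⟩
  intro c a b ha hb
  rw [hL c a b ha hb]
  refine ⟨fun hab => card_le_card (sub ha hb hab), fun hle => ?_⟩
  by_contra hab
  refine absurd hle (not_le.2 (card_lt_card ((ssubset_iff_of_subset
    (sub hb ha ((htotal a b).resolve_left hab))).2 ⟨b, ?_, ?_⟩)))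
  · exact mem_filter.2 ⟨mem_univ _, c, hstrict' hb ha hab⟩
  · rw [mem_filter]
    rintro ⟨-, c', hc'⟩
    exact P.not_strict_self _ _ hc'

theorem Profile.BipartiteComplete.rankedBy_rank {P : Profile A} {U : Finset A}
    (hc : P.BipartiteComplete U) (h : P.FromWeakMasterList) : P.RankedBy P.rank := by
  refine h.rankedBy_rank fun _ c' a b d ha hb hd ha' _ _ _ => ⟨c', hd, ?_⟩
  rw [hc] at *
  tauto

theorem Profile.Complete.rankedBy_rank {P : Profile A} (hc : P.Complete)
    (h : P.FromWeakMasterList) : P.RankedBy P.rank :=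
  h.rankedBy_rank fun _ _ a b d _ _ _ _ hab hda _ =>
    ⟨a, (hc a d).2 hda.symm, (hc a b).2 hab⟩

end Rank

/-! ## The algorithm -/

/-- The places in the code of an instance: the number `n` of agents, the position `o` of the second
profile, and the position `q` of the characteristic vector of the men (or of all agents). -/
structure Layout where
  n : ℕ
  o : ℕ
  q : ℕ

/-- Whether `x` is odd, for `x ≤ 2 * n`. -/
def parity (n x : ℕ) : ℕ := ∑ i ∈ range n, if i + i + 1 = x then 1 else 0

/-- Only the summand `i = x / 2` can be nonzero. The machine has no division, hence the sum. -/
theorem parity_eq {n x : ℕ} (h : x ≤ n) : parity n x = x % 2 := by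
  have e : ∀ i, i + i + 1 = x ↔ i = x / 2 ∧ x % 2 = 1 := by omega
  simp only [parity, e]
  rcases Nat.mod_two_eq_zero_or_one x with h0 | h1
  · simp [h0]
  · have : x / 2 < n := by omega
    simp [h1, this]

/-- The number of pairs of partners among the best `x` and the best `y` agents: of the two sides
for `κ = 1`, and of all agents otherwise. -/
def pairsWithin (κ n x y : ℕ) : ℕ :=
  if x = y then if κ = 1 then x else x - parity n x else min x y

theorem pairsWithin_one (n x y : ℕ) : pairsWithin 1 n x y = min x y := by
  unfold pairsWithin
  split_ifs <;> omega

theorem pairsWithin_two {n x : ℕ} (hx : x ≤ n) (y : ℕ) :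
    pairsWithin 2 n x y = partnersWithin x y := by
  simp [pairsWithin, partnersWithin, parity_eq hx]

/-! ### The criterion as a formula in the bits of the code -/

namespace Layout

open RAM

variable (L : Layout) (κ : ℕ) (w : List Bool)

def pref (a b c : ℕ) : ℕ := bit w (L.o + (L.n * L.n + (L.n * (L.n * a) + (L.n * b + c))))

def edge (a b : ℕ) : ℕ := bit w (L.o + (L.n * L.n + L.n * (L.n * L.n)) + (L.n * a + b))

def sign : ℕ := L.o + (L.n * L.n + L.n * (L.n * L.n)) + L.n * L.n

def left (a : ℕ) : ℕ := bit w (L.q + a)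

/-- For `κ = 1` this is the complement of the set read by `left`, for `κ = 2` the same set. -/
def right (a : ℕ) : ℕ := if bit w (L.q + a) = κ - 1 then 1 else 0

def strict (a b : ℕ) : ℕ :=
  ∑ c ∈ range L.n, if L.pref w c a b = 0 then 0 else if L.pref w c b a = 0 then 1 else 0

def rank (a : ℕ) : ℕ := ∑ d ∈ range L.n, if L.strict w d a = 0 then 0 else 1

def belowLeft (s : ℕ) : ℕ :=
  ∑ a ∈ range L.n, if L.left w a = 0 then 0 else if L.rank w a < s then 1 else 0

def belowRight (s : ℕ) : ℕ :=
  ∑ a ∈ range L.n, if L.right κ w a = 0 then 0 else if L.rank w a < s then 1 else 0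

def dart (a b : ℕ) : ℕ :=
  if L.left w a = 0 then 0 else if L.right κ w b = 0 then 0 else L.edge w a b

def darts : ℕ := ∑ a ∈ range L.n, ∑ b ∈ range L.n, L.dart κ w a b

def dartsAt (t t' : ℕ) : ℕ :=
  ∑ a ∈ range L.n, ∑ b ∈ range L.n,
    if L.rank w a = t then if L.rank w b = t' then L.dart κ w a b else 0 else 0

def overlap : ℕ :=
  ∑ t ∈ range L.n, ∑ t' ∈ range L.n,
    min (edgesAt (pairsWithin κ L.n) (L.belowLeft w) (L.belowRight κ w) t t') (L.dartsAt κ w t t')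

def answer : ℕ :=
  -- A negative bound is never met, so the comparison can be made in the natural numbers.
  if bit w L.sign = 0 then
    if L.darts κ w + pairsWithin κ L.n (L.belowLeft w L.n) (L.belowRight κ w L.n) ≤
      κ * binaryFrom w (L.sign + 1) + 2 * L.overlap κ w then 1 else 0
  else 0

/-! ### Running time -/

section PolyTime

open Context

variable {α : Type} [Context α]

/-- The bound `n_le` is what permits sums over all agents. -/
structure PolyTime (L : α → Layout) : Prop where
  n : RAM.PolyTime fun x => (L x).n
  n_le : ∀ x, (L x).n ≤ (word x).length
  o : RAM.PolyTime fun x => (L x).o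
  q : RAM.PolyTime fun x => (L x).q

variable {L : α → Layout} {κ}

theorem PolyTime.fst (h : PolyTime L) : PolyTime fun x : α × ℕ => L x.1 :=
  ⟨h.n.fst, fun x => h.n_le x.1, h.o.fst, h.q.fst⟩

theorem PolyTime.mul (h : PolyTime L) {f : α → ℕ} (hf : RAM.PolyTime f) :
    RAM.PolyTime fun x => (L x).n * f x :=
  h.n.mul h.n_le hf

theorem PolyTime.sum (h : PolyTime L) {F : α → ℕ → ℕ}
    (hF : RAM.PolyTime fun x : α × ℕ => F x.1 x.2) :
    RAM.PolyTime fun x => ∑ i ∈ range (L x).n, F x i :=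
  h.n.sum h.n_le hF

variable {f f' f'' : α → ℕ} (h : PolyTime L) (hf : RAM.PolyTime f) (hf' : RAM.PolyTime f')

include h

theorem PolyTime.sign : RAM.PolyTime fun x => (L x).sign :=
  (h.o.add ((h.mul h.n).add (h.mul (h.mul h.n)))).add (h.mul h.n)

include hf

theorem PolyTime.left : RAM.PolyTime fun x => (L x).left (word x) (f x) :=
  (h.q.add hf).bit

theorem PolyTime.right : RAM.PolyTime fun x => (L x).right κ (word x) (f x) :=
  (h.q.add hf).bit.ite_eq (.const _) (.const _) (.const _)

include hf'

theorem PolyTime.edge : RAM.PolyTime fun x => (L x).edge (word x) (f x) (f' x) :=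
  ((h.o.add ((h.mul h.n).add (h.mul (h.mul h.n)))).add ((h.mul hf).add hf')).bit

theorem PolyTime.dart : RAM.PolyTime fun x => (L x).dart κ (word x) (f x) (f' x) :=
  (h.left hf).ite_eq_zero (.const _) ((h.right hf').ite_eq_zero (.const _) (h.edge hf hf'))

theorem PolyTime.pref (hf'' : RAM.PolyTime f'') :
    RAM.PolyTime fun x => (L x).pref (word x) (f x) (f' x) (f'' x) :=
  (h.o.add ((h.mul h.n).add ((h.mul (h.mul hf)).add ((h.mul hf').add hf'')))).bit

theorem PolyTime.strict : RAM.PolyTime fun x => (L x).strict (word x) (f x) (f' x) :=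
  h.sum (F := fun x c => if (L x).pref (word x) c (f x) (f' x) = 0 then 0 else
      if (L x).pref (word x) c (f' x) (f x) = 0 then 1 else 0)
    ((h.fst.pref .last hf.fst hf'.fst).ite_eq_zero (.const _)
      ((h.fst.pref .last hf'.fst hf.fst).ite_eq_zero (.const _) (.const _)))

theorem PolyTime.pairsWithin :
    RAM.PolyTime fun x => StableRoommates.pairsWithin κ (L x).n (f x) (f' x) :=
  hf.ite_eq hf' (RAM.PolyTime.ite_eq (.const _) (.const _) hf
    (hf.sub (h.sum (F := fun x i => if i + i + 1 = f x then 1 else 0)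
      (((RAM.PolyTime.last.add .last).add (.const 1)).ite_eq hf.fst (.const _) (.const _)))))
    (hf.min hf')

omit hf'

theorem PolyTime.rank : RAM.PolyTime fun x => (L x).rank (word x) (f x) :=
  h.sum (F := fun x d => if (L x).strict (word x) d (f x) = 0 then 0 else 1)
    ((h.fst.strict .last hf.fst).ite_eq_zero (.const _) (.const _))

theorem PolyTime.belowLeft : RAM.PolyTime fun x => (L x).belowLeft (word x) (f x) :=
  h.sum (F := fun x a => if (L x).left (word x) a = 0 then 0 else
      if (L x).rank (word x) a < f x then 1 else 0)
    ((h.fst.left .last).ite_eq_zero (.const _)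
      ((h.fst.rank .last).ite_lt hf.fst (.const _) (.const _)))

theorem PolyTime.belowRight : RAM.PolyTime fun x => (L x).belowRight κ (word x) (f x) :=
  h.sum (F := fun x a => if (L x).right κ (word x) a = 0 then 0 else
      if (L x).rank (word x) a < f x then 1 else 0)
    ((h.fst.right .last).ite_eq_zero (.const _)
      ((h.fst.rank .last).ite_lt hf.fst (.const _) (.const _)))

include hf'

theorem PolyTime.dartsAt : RAM.PolyTime fun x => (L x).dartsAt κ (word x) (f x) (f' x) :=
  h.sum (F := fun x a => ∑ b ∈ range (L x).n, if (L x).rank (word x) a = f x then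
      if (L x).rank (word x) b = f' x then (L x).dart κ (word x) a b else 0 else 0)
    (h.fst.sum (F := fun x b => if (L x.1).rank (word x) x.2 = f x.1 then
        if (L x.1).rank (word x) b = f' x.1 then (L x.1).dart κ (word x) x.2 b else 0 else 0)
      ((h.fst.fst.rank RAM.PolyTime.last.fst).ite_eq hf.fst.fst
        ((h.fst.fst.rank .last).ite_eq hf'.fst.fst (h.fst.fst.dart RAM.PolyTime.last.fst .last)
          (.const _)) (.const _)))

theorem PolyTime.edgesAt : RAM.PolyTime fun x =>
    StableRoommates.edgesAt (StableRoommates.pairsWithin κ (L x).n) ((L x).belowLeft (word x))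
      ((L x).belowRight κ (word x)) (f x) (f' x) :=
  (((h.pairsWithin (h.belowLeft (hf.add (.const 1))) (h.belowRight (hf'.add (.const 1)))).add
    (h.pairsWithin (h.belowLeft hf) (h.belowRight hf'))).sub
    (h.pairsWithin (h.belowLeft hf) (h.belowRight (hf'.add (.const 1))))).sub
    (h.pairsWithin (h.belowLeft (hf.add (.const 1))) (h.belowRight hf'))

omit hf hf'

theorem PolyTime.darts : RAM.PolyTime fun x => (L x).darts κ (word x) :=
  h.sum (F := fun x a => ∑ b ∈ range (L x).n, (L x).dart κ (word x) a b)
    (h.fst.sum (F := fun x b => (L x.1).dart κ (word x) x.2 b)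
      (h.fst.fst.dart RAM.PolyTime.last.fst .last))

theorem PolyTime.overlap : RAM.PolyTime fun x => (L x).overlap κ (word x) :=
  h.sum (F := fun x t => ∑ t' ∈ range (L x).n,
      min (StableRoommates.edgesAt (StableRoommates.pairsWithin κ (L x).n)
        ((L x).belowLeft (word x)) ((L x).belowRight κ (word x)) t t')
        ((L x).dartsAt κ (word x) t t'))
    (h.fst.sum (F := fun x t' =>
      min (StableRoommates.edgesAt (StableRoommates.pairsWithin κ (L x.1).n)
        ((L x.1).belowLeft (word x)) ((L x.1).belowRight κ (word x)) x.2 t')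
        ((L x.1).dartsAt κ (word x) x.2 t'))
      ((h.fst.fst.edgesAt RAM.PolyTime.last.fst .last).min
        (h.fst.fst.dartsAt RAM.PolyTime.last.fst .last)))

theorem PolyTime.answer (hlen : RAM.PolyTime fun x : α => (word x).length) :
    RAM.PolyTime fun x => (L x).answer κ (word x) :=
  h.sign.bit.ite_eq_zero
    ((h.darts.add (h.pairsWithin (h.belowLeft h.n) (h.belowRight h.n))).ite_le
      (((RAM.PolyTime.binaryFrom hlen (h.sign.add (.const 1))).const_mul κ).add
        (h.overlap.const_mul 2)) (.const _) (.const _)) (.const _)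

end PolyTime

end Layout

end StableRoommates

namespace StableRoommates

open Finset RAM

/-! ### Correctness -/

section Correctness

open Classical in
/-- The layout `L` of the code `w` is that of the profile `P`, the matching `M` and the bound `k`,
where pairs of partners are counted between `V` and `V'`. -/
structure Layout.Reads (L : Layout) (κ : ℕ) (w : List Bool) (P : Profile (Fin L.n))
    (M : Finset (Sym2 (Fin L.n))) (k : ℤ) (V V' : Finset (Fin L.n)) : Prop where
  pref : ∀ a b c : Fin L.n, L.pref w a b c = if P.Pref a b c then 1 else 0
  edge : ∀ a b : Fin L.n, L.edge w a b = if s(a, b) ∈ M then 1 else 0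
  sign : bit w L.sign = if k < 0 then 1 else 0
  abs : binaryFrom w (L.sign + 1) = k.natAbs
  left : ∀ a : Fin L.n, L.left w a = if a ∈ V then 1 else 0
  right : ∀ a : Fin L.n, L.right κ w a = if a ∈ V' then 1 else 0

namespace Layout.Reads

variable {L : Layout} {κ : ℕ} {w : List Bool} {P : Profile (Fin L.n)}
  {M : Finset (Sym2 (Fin L.n))} {k : ℤ} {V V' : Finset (Fin L.n)} (h : L.Reads κ w P M k V V')

include h

theorem rank_eq (a : Fin L.n) : L.rank w a = P.rank a := by
  classical
  have hs : ∀ d : Fin L.n, L.strict w d a = 0 ↔ ¬ ∃ c, P.Strict c d a := by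
    intro d
    rw [Layout.strict, sum_range, sum_eq_zero_iff, not_exists]
    simp only [mem_univ, true_imp_iff, h.pref]
    refine forall_congr' fun c => ?_
    rw [Profile.Strict]
    by_cases h1 : P.Pref c d a <;> by_cases h2 : P.Pref c a d <;> simp [h1, h2]
  rw [Layout.rank, sum_range, Profile.rank, card_filter]
  refine sum_congr rfl fun d _ => ?_
  simp only [hs, ite_not]
  congr

theorem belowLeft_eq (s : ℕ) : L.belowLeft w s = below V P.rank s := by
  rw [below, card_filter, Layout.belowLeft, sum_range, ← univ_inter V, ← sum_ite_mem]
  refine sum_congr rfl fun a _ => ?_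
  rw [h.left, h.rank_eq]
  by_cases ha : a ∈ V <;> simp [ha]

theorem belowRight_eq (s : ℕ) : L.belowRight κ w s = below V' P.rank s := by
  rw [below, card_filter, Layout.belowRight, sum_range, ← univ_inter V', ← sum_ite_mem]
  refine sum_congr rfl fun a _ => ?_
  rw [h.right, h.rank_eq]
  by_cases ha : a ∈ V' <;> simp [ha]

theorem dart_eq (a b : Fin L.n) :
    L.dart κ w a b = if (a, b) ∈ V ×ˢ V' then if s(a, b) ∈ M then 1 else 0 else 0 := by
  rw [Layout.dart, h.left, h.right, h.edge]
  by_cases ha : a ∈ V <;> by_cases hb : b ∈ V' <;> simp [ha, hb]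

theorem darts_eq : L.darts κ w = cardDarts V V' M := by
  rw [cardDarts, card_filter, Layout.darts, sum_range, ← univ_inter (V ×ˢ V'), ← sum_ite_mem,
    Fintype.sum_prod_type]
  refine sum_congr rfl fun a _ => ?_
  rw [sum_range]
  exact sum_congr rfl fun b _ => h.dart_eq a b

theorem dartsAt_eq (t t' : ℕ) : L.dartsAt κ w t t' = cardDartsAt V V' P.rank M t t' := by
  rw [cardDartsAt, card_filter, Layout.dartsAt, sum_range, ← univ_inter (V ×ˢ V'), ← sum_ite_mem,
    Fintype.sum_prod_type]
  refine sum_congr rfl fun a _ => ?_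
  rw [sum_range]
  refine sum_congr rfl fun b _ => ?_
  rw [h.dart_eq, h.rank_eq, h.rank_eq]
  by_cases ha : P.rank a = t <;> by_cases hb : P.rank b = t' <;> simp [ha, hb]

theorem answer_eq {Yes : Prop} [Decidable Yes] (hno : k < 0 → ¬ Yes)
    (hyes : Yes ↔ ((cardDarts V V' M + pairsWithin κ L.n (below V P.rank L.n) (below V' P.rank L.n) :
      ℕ) : ℤ) ≤ κ * k + (2 * ∑ t ∈ range L.n, ∑ t' ∈ range L.n,
        min (edgesAt (pairsWithin κ L.n) (below V P.rank) (below V' P.rank) t t')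
          (cardDartsAt V V' P.rank M t t') : ℕ)) :
    L.answer κ w = if Yes then 1 else 0 := by
  rw [Layout.answer, h.sign]
  rcases lt_or_ge k 0 with hk | hk
  · simp [hk, hno hk]
  · have hL : L.belowLeft w = below V P.rank := funext h.belowLeft_eq
    have hR : L.belowRight κ w = below V' P.rank := funext h.belowRight_eq
    rw [if_neg (not_lt.2 hk), if_pos rfl, h.abs, Layout.overlap, h.darts_eq, hL, hR]
    simp only [h.dartsAt_eq]
    refine if_congr (Iff.trans ?_ hyes.symm) rfl rfl
    rw [← Nat.cast_le (α := ℤ), Nat.cast_add (κ * _), Nat.cast_mul κ, Int.natAbs_of_nonneg hk]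

end Layout.Reads

theorem below_le {n : ℕ} (V : Finset (Fin n)) (r : Fin n → ℕ) (s : ℕ) : below V r s ≤ n :=
  (card_le_univ _).trans (Fintype.card_fin n).le

theorem ISRT.not_yes_of_neg {I : ISRT} (h : I.k < 0) : ¬ I.Yes := by
  rintro ⟨M, -, hM⟩
  omega

theorem ISMT.answer_eq {I : ISMT} (hc : I.P₂.BipartiteComplete I.U)
    (hL : I.P₂.FromWeakMasterList) {o q : ℕ} {w : List Bool}
    (h : Layout.Reads ⟨I.n, o, q⟩ 1 w I.P₂ I.M₁ I.k I.U I.Uᶜ) [Decidable I.Yes] :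
    Layout.answer ⟨I.n, o, q⟩ 1 w = if I.Yes then 1 else 0 := by
  have hP := hc.rankedBy_rank hL
  refine h.answer_eq (Yes := I.Yes) ISRT.not_yes_of_neg ?_
  -- Each edge is counted once, from the men to the women.
  refine exists_stable_card_symmDiff_le_iff (v := false)
    (edge := fun a b => a ∈ I.U ↔ b ∉ I.U) hP
    (fun a => (I.P₂.rank_lt_card a).trans_eq (Fintype.card_fin _)) Nat.zero_lt_one
    (by simp) I.stable₁.1.disjointEdges
    (fun a b hab => I.bip₁ a b (I.stable₁.1.1 a b hab).2.1) I.bip₂ (fun M hM => ?_)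
    (fun π hπ a b => ?_) fun M hM s s' => ?_
  · rw [one_mul]
    exact card_eq_card_darts_of_bipartite hM
  · rw [hc, hc, hπ, hπ]
  · rw [pairsWithin_one]
    exact card_darts_of_bipartiteComplete hP hc hM s s'

theorem ISRT.answer_eq {I : ISRT} (hc : I.P₂.Complete)
    (hL : I.P₂.FromWeakMasterList) {o q : ℕ} {w : List Bool}
    (h : Layout.Reads ⟨I.n, o, q⟩ 2 w I.P₂ I.M₁ I.k univ univ) [Decidable I.Yes] :
    Layout.answer ⟨I.n, o, q⟩ 2 w = if I.Yes then 1 else 0 := by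
  have hP := hc.rankedBy_rank hL
  refine h.answer_eq (Yes := I.Yes) ISRT.not_yes_of_neg ?_
  -- There are no sides, so each edge is counted in both directions.
  refine exists_stable_card_symmDiff_le_iff (v := true)
    (edge := fun a b => a ≠ b) hP
    (fun a => (I.P₂.rank_lt_card a).trans_eq (Fintype.card_fin _)) Nat.two_pos
    (by simp) I.stable₁.1.disjointEdges
    (fun a b hab => (I.stable₁.1.1 a b hab).1) (fun a b => (hc a b).1) (fun M hM => ?_)
    (fun π _ a b => ?_) fun M hM s s' => ?_
  · rw [two_mul_card_eq_card_darts hM, cardDarts, univ_product_univ]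
  · rw [hc, hc, π.injective.ne_iff]
  · rw [pairsWithin_two (below_le _ _ _), univ_product_univ]
    exact card_darts_of_complete hP hc hM s s'

end Correctness

/-! ### The layouts of the codes -/

section Codes

/-- Both codes end with the second profile, the matching and the bound; `v` is whatever precedes
them, including the first profile. -/
theorem Layout.reads_of_append {n o q κ : ℕ} {v : List Bool} (P : Profile (Fin n))
    (M : Finset (Sym2 (Fin n))) (k : ℤ) {V V' : Finset (Fin n)} (hv : v.length = o)
    (hl : ∀ a : Fin n, Layout.left ⟨n, o, q⟩
      (v ++ encodeProfile P ++ encodeMatching M ++ encodeInt k) a = if a ∈ V then 1 else 0)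
    (hr : ∀ a : Fin n, Layout.right ⟨n, o, q⟩ κ
      (v ++ encodeProfile P ++ encodeMatching M ++ encodeInt k) a = if a ∈ V' then 1 else 0) :
    Layout.Reads ⟨n, o, q⟩ κ (v ++ encodeProfile P ++ encodeMatching M ++ encodeInt k)
      P M k V V' := by
  classical
  subst hv
  have hP := length_encodeProfile P
  have hM := length_encodeMatching M
  have hvP : (v ++ encodeProfile P).length = v.length + (n * n + n * (n * n)) := by
    rw [List.length_append, hP]
  have hvPM : (v ++ encodeProfile P ++ encodeMatching M).length =
      v.length + (n * n + n * (n * n)) + n * n := by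
    rw [List.length_append, hvP, hM]
  have lt₂ : ∀ a b : Fin n, n * (a : ℕ) + b < n * n := by
    intro a b
    have h1 := Nat.mul_le_mul_left n (Nat.succ_le_iff.2 a.2)
    have h2 := b.2
    rw [Nat.succ_eq_add_one, mul_add] at h1
    omega
  refine ⟨fun a b c => ?_, fun a b => ?_, ?_, ?_, hl, hr⟩
  · have h3 : n * (n * (a : ℕ)) + (n * b + c) < n * (n * n) := by
      have h1 := Nat.mul_le_mul_left n (Nat.mul_le_mul_left n (show (a : ℕ) + 1 ≤ n from a.2))
      have h2 := lt₂ b c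
      rw [mul_add, mul_add, mul_one] at h1
      omega
    have hlt : v.length + (n * n + (n * (n * (a : ℕ)) + (n * b + c))) <
        (v ++ encodeProfile P).length := by
      rw [hvP]
      omega
    rw [Layout.pref, List.append_assoc, bit_append_left hlt, bit_append_right, bit_encodeProfile]
  · have := lt₂ a b
    have hlt : v.length + (n * n + n * (n * n)) + (n * a + b) <
        (v ++ encodeProfile P ++ encodeMatching M).length := by
      rw [hvPM]
      omega
    rw [Layout.edge, bit_append_left hlt, ← hvP, bit_append_right, bit_encodeMatching]
  · rw [Layout.sign, ← hvPM, ← Nat.add_zero (List.length _), bit_append_right]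
    exact toNat_decide _
  · have e : v ++ encodeProfile P ++ encodeMatching M ++ encodeInt k =
        (v ++ encodeProfile P ++ encodeMatching M ++ [decide (k < 0)]) ++ k.natAbs.bits := by
      simp [encodeInt]
    rw [e, Layout.sign, ← hvPM]
    convert binaryFrom_append_bits _ _ using 2
    simp [Nat.add_assoc]

def ISRT.layout (I : ISRT) : Layout := ⟨I.n, I.n + 1 + (I.n * I.n + I.n * (I.n * I.n)), 0⟩

def ISMT.layout (I : ISMT) : Layout :=
  ⟨I.n, I.n + 1 + I.n + (I.n * I.n + I.n * (I.n * I.n)), I.n + 1⟩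

theorem ISRT.reads (I : ISRT) :
    I.layout.Reads 2 I.encode I.P₂ I.M₁ I.k univ univ := by
  -- The unary code of the number of agents, at position 0, doubles as the characteristic vector of
  -- all agents.
  have h : ∀ a : Fin I.n, bit I.encode (0 + a) = 1 := by
    intro a
    simp only [ISRT.encode, List.append_assoc]
    rw [bit_append_left (by simp)]
    simp [bit]
  refine Layout.reads_of_append I.P₂ I.M₁ I.k ?_ (fun a => ?_) fun a => ?_
  · simp [length_encodeProfile]
    ring
  · exact (h a).trans (if_pos (mem_univ _)).symm
  · exact (if_pos (h a)).trans (if_pos (mem_univ _)).symm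

theorem ISMT.reads (I : ISMT) :
    I.layout.Reads 1 I.encode I.P₂ I.M₁ I.k I.U I.Uᶜ := by
  classical
  have h : ∀ a : Fin I.n, bit I.encode (I.n + 1 + a) = if a ∈ I.U then 1 else 0 := by
    intro a
    have hl : (List.replicate I.n true ++ [false]).length = I.n + 1 := by simp
    have e : I.encode = (List.replicate I.n true ++ [false]) ++ (encodeSet I.U ++
        (encodeProfile I.P₁ ++ encodeProfile I.P₂ ++ encodeMatching I.M₁ ++ encodeInt I.k)) := by
      simp [ISMT.encode]
    rw [e, ← hl, bit_append_right, bit_append_left (by simp [length_encodeSet]), bit_encodeSet]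
  refine Layout.reads_of_append I.P₂ I.M₁ I.k ?_ (fun a => ?_) fun a => ?_
  · simp [length_encodeProfile, length_encodeSet]
    ring
  · exact h a
  · have e : (if (if a ∈ I.U then 1 else 0) = 0 then 1 else 0) = if a ∈ I.Uᶜ then 1 else 0 := by
      by_cases ha : a ∈ I.U <;> simp [ha]
    exact (congrArg (fun x => if x = 0 then 1 else 0) (h a)).trans e

theorem ISRT.leadingOnes_encode (I : ISRT) : leadingOnes I.encode = I.n := by
  simp only [ISRT.encode, List.append_assoc, List.singleton_append]
  exact leadingOnes_replicate_append _ _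

theorem ISMT.leadingOnes_encode (I : ISMT) : leadingOnes I.encode = I.n := by
  simp only [ISMT.encode, List.append_assoc, List.singleton_append]
  exact leadingOnes_replicate_append _ _

theorem ISRT.n_le_length_encode (I : ISRT) : I.n ≤ I.encode.length := by
  simp only [ISRT.encode, List.append_assoc, List.length_append, List.length_replicate]
  exact Nat.le_add_right _ _

theorem ISMT.n_le_length_encode (I : ISMT) : I.n ≤ I.encode.length := by
  simp only [ISMT.encode, List.append_assoc, List.length_append, List.length_replicate]
  exact Nat.le_add_right _ _

end Codes

/-! ### Polynomial-time solvability of both problems -/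

theorem ISMT.solvableInPolyTime : SolvableInPolyTime ISMT.encode
    (fun I => I.P₂.BipartiteComplete I.U ∧ I.P₂.FromWeakMasterList) ISMT.Yes := by
  classical
  let := Context.ofEncoding (fun I : {I : ISMT // I.P₂.BipartiteComplete I.U ∧
    I.P₂.FromWeakMasterList} => I.1.encode)
  refine SolvableInPolyTime.of_polyTime (f := fun I => I.1.layout.answer 1 I.1.encode) ?_
    fun I => ?_
  · have hlen := PolyTime.length (fun I : {I : ISMT // I.P₂.BipartiteComplete I.U ∧
      I.P₂.FromWeakMasterList} => I.1.encode)
    -- The number of agents is read off the unary prefix; all offsets are polynomials in it.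
    have hn := PolyTime.leadingOnes hlen
    simp only [Context.word, ISMT.leadingOnes_encode] at hn
    have hb := fun I : {I : ISMT // I.P₂.BipartiteComplete I.U ∧ I.P₂.FromWeakMasterList} =>
      I.1.n_le_length_encode
    have hm := fun {f} hf => PolyTime.mul (f := f) hn hb hf
    exact Layout.PolyTime.answer ⟨hn, hb, ((hn.add (.const 1)).add hn).add
      ((hm hn).add (hm (hm hn))), hn.add (.const 1)⟩ hlen
  · exact (ISMT.answer_eq I.2.1 I.2.2 I.1.reads).trans (by congr)

theorem ISRT.solvableInPolyTime : SolvableInPolyTime ISRT.encode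
    (fun I => I.P₂.Complete ∧ I.P₂.FromWeakMasterList) ISRT.Yes := by
  classical
  let := Context.ofEncoding (fun I : {I : ISRT // I.P₂.Complete ∧
    I.P₂.FromWeakMasterList} => I.1.encode)
  refine SolvableInPolyTime.of_polyTime (f := fun I => I.1.layout.answer 2 I.1.encode) ?_
    fun I => ?_
  · have hlen := PolyTime.length (fun I : {I : ISRT // I.P₂.Complete ∧
      I.P₂.FromWeakMasterList} => I.1.encode)
    have hn := PolyTime.leadingOnes hlen
    simp only [Context.word, ISRT.leadingOnes_encode] at hn
    have hb := fun I : {I : ISRT // I.P₂.Complete ∧ I.P₂.FromWeakMasterList} =>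
      I.1.n_le_length_encode
    have hm := fun {f} hf => PolyTime.mul (f := f) hn hb hf
    exact Layout.PolyTime.answer ⟨hn, hb, (hn.add (.const 1)).add
      ((hm hn).add (hm (hm hn))), .const 0⟩ hlen
  · exact (ISRT.answer_eq I.2.1 I.2.2 I.1.reads).trans (by congr)

end StableRoommates

theorem mainTheorem8 :
    RAM.SolvableInPolyTime StableRoommates.ISMT.encode
      (fun I => I.P₂.BipartiteComplete I.U ∧ I.P₂.FromWeakMasterList)
      StableRoommates.ISMT.Yes ∧
    RAM.SolvableInPolyTime StableRoommates.ISRT.encode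
      (fun I => I.P₂.Complete ∧ I.P₂.FromWeakMasterList)
      StableRoommates.ISRT.Yes :=
  ⟨StableRoommates.ISMT.solvableInPolyTime, StableRoommates.ISRT.solvableInPolyTime⟩
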